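/- Let $k$ be an algebraically closed field and $G$ a group. Conventions. All functors between $k$-categories are $k$-linear. A $k$-category $\mathcal C$ (with non-empty object set $\mathcal C_0$) is locally bounded if distinct objects are not isomorphic, every endomorphism algebra $\mathcal C(x,x)$ is local, and $\bigoplus_y\mathcal C(x,y)$ and $\bigoplus_y\mathcal C(y,x)$ are finite dimensional for each $x$. It is connected if any two objects are joined by a finite sequence of objects such that between consecutive ones there is a non-zero morphism in one direction or the other. Its radical $\mathcal R$ consists of the non-invertible morphisms, and its ordinary quiver has vertex set $\mathcal C_0$ and exactly $\dim_k \mathcal R(x,y)/\mathcal R^2(x,y)$ arrows $x\to y$. For a locally finite quiver $Q$ let $kQ$ be its path category; an ideal $I$ of $kQ$ is admissible if $I\subseteq (kQ^+)^2$ (the span of the paths of length at least $2$) and for every vertex $x$ there is $n\ge 2$ such that $I$ contains all paths of length at least $n$ with source or target $x$. An admissible presentation of $\mathcal C$ is an isomorphism of $k$-categories $kQ/I\to\mathcal C$ with $Q$ the ordinary quiver of $\mathcal C$ and $I$ admissible. A Galois covering $F\colon\hat{\mathcal C}\to\mathcal C$ with group $G$ is a functor, where $G$ acts on $\hat{\mathcal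 C}$ by automorphisms, freely on objects, such that $F$ is the composite of the projection $\hat{\mathcal C}\to\hat{\mathcal C}/G$ with an isomorphism $\hat{\mathcal C}/G\to\mathcal C$. Here $\hat{\mathcal C}/G$ has the orbits as objects, $(\hat{\mathcal C}/G)(\alpha,\beta)=\bigl(\bigoplus_{x\in\alpha,\,y\in\beta}\hat{\mathcal C}(x,y)\bigr)/G$ (the quotient by the subspace spanned by the elements $gu-u$), and the induced composition. A minimal relation of $(Q,I)$ is a non-zero $r=\sum_i t_iu_i\in I(x,y)$ ($t_i\in k^*$, $u_i$ distinct paths) no non-empty proper subsum of which lies in $I$. A covering of quivers with admissible relations $p\colon(Q',I')\to(Q,I)$ is a morphism of quivers $p\colon Q'\to Q$ with $p(I')\subseteq I$, surjective on vertices, bijective from the arrows starting (resp. ending) at each vertex $x'$ of $Q'$ to those starting (resp. ending) at $p(x')$, and such that for every minimal relation $r\in I(x,y)$ and every $x'\in p^{-1}(x)$ (resp. every $y'\in p^{-1}(y)$) there are $y'\in p^{-1}(y)$ (resp. $x'\in p^{-1}(x)$) and $r'\in I'(x',y')$ with $p(r')=r$. It induces a functor $\bar p\colon kQ'/I'\to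 kQ/I$. It is Galois with group $G$ if $Q$ and $Q'$ are connected and $G$ is (identified with) a group of automorphisms $g$ of the quiver $Q'$ with $g(I')\subseteq I'$ and $p\circ g=p$, acting transitively on each fibre $p^{-1}(x)$, $x\in Q_0$. Proposition. Let $F\colon\hat{\mathcal C}\to\mathcal C$ be a Galois covering with group $G$, where $\mathcal C$ and $\hat{\mathcal C}$ are locally bounded $k$-categories. Then there exist admissible presentations $\varphi\colon kQ/I'\xrightarrow{\sim}\mathcal C$ and $\psi\colon k\hat Q/\hat I\xrightarrow{\sim}\hat{\mathcal C}$ and a covering of quivers with admissible relations $p\colon(\hat Q,\hat I)\to(Q,I')$ such that $\varphi$ restricts to the identity map $Q_0=\mathcal C_0\to\mathcal C_0$ on objects and $F\circ\psi=\varphi\circ\bar p$. If moreover $\hat{\mathcal C}$ is connected, then $p$ is a Galois covering with group $G$. (No assumption is made on the ordinary quivers: they may have loops, oriented cycles and multiple arrows.) -/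

import Mathlib

open CategoryTheory

universe w v u v₁ v₂ u₁ u₂ u₃

noncomputable section

/-! ### Locally bounded categories, radical, ordinary quiver -/

section LocallyBounded

variable (k : Type w) [Field k] (C : Type u) [Category.{v} C] [Preadditive C] [Linear k C]

/-- Locally bounded `k`-categories. (`IsLocalRing` makes sense for noncommutative rings.) -/
structure IsLocallyBounded : Prop where
  nonempty : Nonempty C
  eq_of_iso : ∀ x y : C, Nonempty (x ≅ y) → x = y
  isLocalRing_end : ∀ x : C, IsLocalRing (End x)
  finite_source : ∀ x : C, Module.Finite k (DirectSum C fun y => (x ⟶ y))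
  finite_target : ∀ y : C, Module.Finite k (DirectSum C fun x => (x ⟶ y))

/-- Connected `k`-categories: any two objects are joined by a finite sequence of objects such that
between consecutive ones there is a nonzero morphism, in one direction or the other. -/
def IsConnectedLinearCategory : Prop :=
  Nonempty C ∧ ∀ x y : C, Relation.ReflTransGen
    (fun a b : C => (∃ f : a ⟶ b, f ≠ 0) ∨ (∃ f : b ⟶ a, f ≠ 0)) x y

variable {C}

/-- The radical. In a locally bounded category the non-invertible morphisms `x ⟶ y` already form
a subspace, see `mem_radical_iff`. -/
def radical (x y : C) : Submodule k (x ⟶ y) := Submodule.span k {f | ¬ IsIso f}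

/-- The square of the radical. -/
def radicalSq (x y : C) : Submodule k (x ⟶ y) :=
  Submodule.span k {h | ∃ (z : C) (f : x ⟶ z) (g : z ⟶ y),
    f ∈ radical k x z ∧ g ∈ radical k z y ∧ h = f ≫ g}

variable {k}

theorem isUnit_or_isUnit_of_isUnit_add' {R : Type*} [Ring R] [IsLocalRing R] {a b : R}
    (h : IsUnit (a + b)) : IsUnit a ∨ IsUnit b := by
  obtain ⟨c, hc⟩ := h
  have h1 : a * ((c⁻¹ : Rˣ) : R) + b * ((c⁻¹ : Rˣ) : R) = 1 := by
    rw [← add_mul, ← hc, c.mul_inv]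
  exact (IsLocalRing.isUnit_or_isUnit_of_add_one h1).imp
    (Units.isUnit_mul_units a c⁻¹).1 (Units.isUnit_mul_units b c⁻¹).1

theorem mem_radical_iff (hC : IsLocallyBounded k C) {x y : C} (f : x ⟶ y) :
    f ∈ radical k x y ↔ ¬ IsIso f := by
  refine ⟨fun hf => ?_, fun hf => Submodule.subset_span hf⟩
  by_cases hxy : x = y
  · subst hxy
    have := hC.isLocalRing_end x
    have key : ∀ f : x ⟶ x, IsUnit (M := End x) f ↔ IsIso f := fun f => isUnit_iff_isIso f
    have key0 : ¬ IsIso (0 : x ⟶ x) := fun h => not_isUnit_zero (M₀ := End x) ((key 0).2 h)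
    refine Submodule.span_induction (p := fun f _ => ¬ IsIso f) (fun f h => h) key0 ?_ ?_ hf
    · intro f g _ _ h₁ h₂ h
      rcases isUnit_or_isUnit_of_isUnit_add' (R := End x) ((key (f + g)).2 h) with h | h
      · exact h₁ ((key f).1 h)
      · exact h₂ ((key g).1 h)
    · intro a f _ h₁ h₂
      by_cases ha : a = 0
      · subst ha
        rw [zero_smul] at h₂
        exact key0 h₂
      · apply h₁
        refine ⟨a • inv (a • f), ?_, ?_⟩
        · rw [Linear.comp_smul, ← Linear.smul_comp, IsIso.hom_inv_id]
        · rw [Linear.smul_comp, ← Linear.comp_smul, IsIso.inv_hom_id]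
  · intro h
    exact hxy (hC.eq_of_iso x y ⟨asIso f⟩)

variable (k)

/-- The vertices of the quiver with vertex set `V` and set of arrows `A x y` from `x` to `y`. -/
structure Vert {V : Type u} (A : V → V → Type v) where
  pt : V

instance {V : Type u} (A : V → V → Type v) : Quiver (Vert A) where
  Hom x y := A x.pt y.pt

/-- The family of sets `A x y` is the ordinary quiver of `C`: its vertex set is the set of objects
of `C`, and the number of arrows `x → y` is the dimension of `R(x,y) / R²(x,y)`. -/
def IsOrdinaryQuiver (A : C → C → Type v₁) : Prop :=
  ∀ x y : C, Finite (A x y) ∧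
    Nat.card (A x y) =
      Module.finrank k (radical k x y ⧸ (radicalSq k x y).submoduleOf (radical k x y))

end LocallyBounded

/-! ### Ideals and quotients of linear categories -/

/-- Ideals of a `k`-category. -/
structure CatIdeal (k : Type w) [Field k] (C : Type u) [Category.{v} C] [Preadditive C]
    [Linear k C] where
  hom : ∀ x y : C, Submodule k (x ⟶ y)
  comp_mem : ∀ {x y z : C} (f : x ⟶ y) (g : y ⟶ z), g ∈ hom y z → f ≫ g ∈ hom x z
  mem_comp : ∀ {x y z : C} (f : x ⟶ y) (g : y ⟶ z), f ∈ hom x y → f ≫ g ∈ hom x z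

section IdealQuotient

variable {k : Type w} [Field k] {C : Type u} [Category.{v} C] [Preadditive C] [Linear k C]

/-- Objects of the quotient category `C/I`. -/
structure IdealQuot (I : CatIdeal k C) where
  as : C

namespace IdealQuot

variable (I : CatIdeal k C)

/-- Composition in `C/I`. -/
def compHom (x y z : C) :
    ((x ⟶ y) ⧸ I.hom x y) →ₗ[k] ((y ⟶ z) ⧸ I.hom y z) →ₗ[k] ((x ⟶ z) ⧸ I.hom x z) :=
  Submodule.liftQ _
    (LinearMap.flip <| Submodule.liftQ _
      (LinearMap.flip <| (Linear.comp x y z).compr₂ (I.hom x z).mkQ)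
      (by
        intro g hg
        rw [LinearMap.mem_ker]
        ext f
        exact (Submodule.Quotient.mk_eq_zero _).2 (I.comp_mem f g hg)))
    (by
      intro f hf
      rw [LinearMap.mem_ker]
      ext g
      exact (Submodule.Quotient.mk_eq_zero _).2 (I.mem_comp f g hf))

theorem compHom_mk {x y z : C} (f : x ⟶ y) (g : y ⟶ z) :
    compHom I x y z (Submodule.Quotient.mk f) (Submodule.Quotient.mk g) =
      Submodule.Quotient.mk (f ≫ g) := rfl

instance : Category.{v} (IdealQuot I) where
  Hom x y := (x.as ⟶ y.as) ⧸ I.hom x.as y.as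
  id x := Submodule.Quotient.mk (𝟙 x.as)
  comp f g := compHom I _ _ _ f g
  id_comp f := by
    obtain ⟨f, rfl⟩ := Submodule.Quotient.mk_surjective _ f
    rw [compHom_mk, Category.id_comp]
  comp_id f := by
    obtain ⟨f, rfl⟩ := Submodule.Quotient.mk_surjective _ f
    rw [compHom_mk, Category.comp_id]
  assoc f g h := by
    obtain ⟨f, rfl⟩ := Submodule.Quotient.mk_surjective _ f
    obtain ⟨g, rfl⟩ := Submodule.Quotient.mk_surjective _ g
    obtain ⟨h, rfl⟩ := Submodule.Quotient.mk_surjective _ h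
    rw [compHom_mk, compHom_mk, compHom_mk, compHom_mk, Category.assoc]

instance (x y : IdealQuot I) : AddCommGroup (x ⟶ y) :=
  inferInstanceAs (AddCommGroup ((x.as ⟶ y.as) ⧸ I.hom x.as y.as))

instance (x y : IdealQuot I) : Module k (x ⟶ y) :=
  inferInstanceAs (Module k ((x.as ⟶ y.as) ⧸ I.hom x.as y.as))

instance : Preadditive (IdealQuot I) where
  homGroup _ _ := inferInstance
  add_comp _ _ _ f f' g := LinearMap.map_add₂ (compHom I _ _ _) f f' g
  comp_add _ _ _ f g g' := map_add (compHom I _ _ _ f) g g'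

instance : Linear k (IdealQuot I) where
  homModule _ _ := inferInstance
  smul_comp _ _ _ a f g := LinearMap.map_smul₂ (compHom I _ _ _) a f g
  comp_smul _ _ _ f a g := map_smul (compHom I _ _ _ f) a g

/-- The projection `C ⥤ C/I`. -/
def proj : C ⥤ IdealQuot I where
  obj x := ⟨x⟩
  map {x y} f := (Submodule.Quotient.mk f : (x ⟶ y) ⧸ I.hom x y)

variable {I} {D : Type u₁} [Category.{v₁} D] [Preadditive D] [Linear k D]

/-- A linear functor which maps `I` into `J` induces a functor `C/I ⥤ D/J`. -/
def map {J : CatIdeal k D} (H : C ⥤ D) [H.Additive] [H.Linear k]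
    (hH : ∀ (x y : C) (r : x ⟶ y), r ∈ I.hom x y → H.map r ∈ J.hom (H.obj x) (H.obj y)) :
    IdealQuot I ⥤ IdealQuot J where
  obj x := ⟨H.obj x.as⟩
  map {x y} := Submodule.mapQ (I.hom x.as y.as) (J.hom _ _) (H.mapLinearMap k)
    (fun r hr => hH _ _ r hr)
  map_id x := congrArg Submodule.Quotient.mk (H.map_id x.as)
  map_comp f g := by
    obtain ⟨f, rfl⟩ := Submodule.Quotient.mk_surjective _ f
    obtain ⟨g, rfl⟩ := Submodule.Quotient.mk_surjective _ g
    exact congrArg Submodule.Quotient.mk (H.map_comp f g)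

end IdealQuot

end IdealQuotient

/-! ### Path categories, quivers with admissible relations and their coverings -/

/-- Objects of the path category `kQ` of the quiver `Q` with vertex set `V`. -/
structure PathCat (k : Type w) (V : Type u) where
  pt : V

namespace PathCat

variable {k : Type w} [Field k] {V : Type u} [Quiver.{v} V]

/-- Composition in the path category: the bilinear extension of concatenation. -/
def compHom (x y z : V) :
    (Quiver.Path x y →₀ k) →ₗ[k] (Quiver.Path y z →₀ k) →ₗ[k] (Quiver.Path x z →₀ k) :=
  Finsupp.lsum k fun p => LinearMap.flip <| Finsupp.lsum k fun q =>
    LinearMap.flip <| (LinearMap.mul k k).compr₂ (Finsupp.lsingle (p.comp q))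

theorem compHom_single {x y z : V} (p : Quiver.Path x y) (q : Quiver.Path y z) (a b : k) :
    compHom x y z (Finsupp.single p a) (Finsupp.single q b) =
      Finsupp.single (p.comp q) (a * b) := by
  simp [compHom]

/-- Morphisms `x ⟶ y` of `kQ` are the formal `k`-linear combinations of the oriented paths from
`x` to `y`, the trivial path being included when `x = y`. -/
instance : Category (PathCat k V) where
  Hom x y := Quiver.Path x.pt y.pt →₀ k
  id x := Finsupp.single Quiver.Path.nil 1
  comp f g := compHom _ _ _ f g
  id_comp {x y} f := by
    induction f using Finsupp.induction_linear with
    | zero => exact map_zero _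
    | add f g hf hg => rw [map_add, hf, hg]
    | single p a => rw [compHom_single, Quiver.Path.nil_comp, one_mul]
  comp_id {x y} f := by
    induction f using Finsupp.induction_linear with
    | zero => exact LinearMap.map_zero₂ _ _
    | add f g hf hg => rw [LinearMap.map_add₂, hf, hg]
    | single p a => rw [compHom_single, Quiver.Path.comp_nil, mul_one]
  assoc {x y z t} f g h := by
    induction f using Finsupp.induction_linear with
    | zero => simp only [LinearMap.map_zero₂]
    | add f f' hf hf' => simp only [LinearMap.map_add₂, hf, hf']
    | single p a =>
      induction g using Finsupp.induction_linear with
      | zero => simp only [map_zero, LinearMap.zero_apply]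
      | add g g' hg hg' => simp only [LinearMap.add_apply, map_add, hg, hg']
      | single q b =>
        induction h using Finsupp.induction_linear with
        | zero => simp only [map_zero]
        | add h h' hh hh' => simp only [map_add, hh, hh']
        | single r c => simp only [compHom_single, Quiver.Path.comp_assoc, mul_assoc]

instance (x y : PathCat k V) : AddCommGroup (x ⟶ y) :=
  inferInstanceAs (AddCommGroup (Quiver.Path x.pt y.pt →₀ k))

instance (x y : PathCat k V) : Module k (x ⟶ y) :=
  inferInstanceAs (Module k (Quiver.Path x.pt y.pt →₀ k))

instance : Preadditive (PathCat k V) where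
  homGroup _ _ := inferInstance
  add_comp _ _ _ f f' g := LinearMap.map_add₂ (compHom _ _ _) f f' g
  comp_add _ _ _ f g g' := map_add (compHom _ _ _ f) g g'

instance : Linear k (PathCat k V) where
  homModule _ _ := inferInstance
  smul_comp _ _ _ a f g := LinearMap.map_smul₂ (compHom _ _ _) a f g
  comp_smul _ _ _ f a g := map_smul (compHom _ _ _ f) a g

/-- The coefficients of a morphism of `kQ` in the basis of paths. -/
def coeffs {x y : PathCat k V} (r : x ⟶ y) : Quiver.Path x.pt y.pt →₀ k := r

/-- The morphism of `kQ` with given coefficients. -/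
def ofCoeffs {x y : PathCat k V} (r : Quiver.Path x.pt y.pt →₀ k) : x ⟶ y := r

/-- A path, as a morphism of `kQ`. -/
def ofPath {x y : PathCat k V} (q : Quiver.Path x.pt y.pt) : x ⟶ y :=
  ofCoeffs (Finsupp.single q 1)

variable (k) {W : Type u₁} [Quiver.{v₁} W]

/-- The functor `kQ ⥤ kQ'` induced by a morphism of quivers. -/
def map (p : V ⥤q W) : PathCat k V ⥤ PathCat k W where
  obj x := ⟨p.obj x.pt⟩
  map {x y} r := Finsupp.mapDomain (fun q : Quiver.Path x.pt y.pt => p.mapPath q) r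
  map_id x := by
    exact Finsupp.mapDomain_single
  map_comp {x y z} f g := by
    change Finsupp.mapDomain _ (compHom _ _ _ f g) =
      compHom _ _ _ (Finsupp.mapDomain _ f) (Finsupp.mapDomain _ g)
    induction f using Finsupp.induction_linear with
    | zero => simp only [LinearMap.map_zero₂, Finsupp.mapDomain_zero]
    | add f f' hf hf' => simp only [LinearMap.map_add₂, Finsupp.mapDomain_add, hf, hf']
    | single q a =>
      induction g using Finsupp.induction_linear with
      | zero => simp only [map_zero, Finsupp.mapDomain_zero]
      | add g g' hg hg' => simp only [map_add, Finsupp.mapDomain_add, hg, hg']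
      | single q' b =>
        simp only [compHom_single, Finsupp.mapDomain_single, Prefunctor.mapPath_comp]

instance (p : V ⥤q W) : (map k p).Additive where
  map_add {_ _} f g := Finsupp.mapDomain_add (v₁ := f) (v₂ := g)

instance (p : V ⥤q W) : (map k p).Linear k where
  map_smul {_ _} f a := Finsupp.mapDomain_smul a f

end PathCat

section BoundQuivers

variable {k : Type w} [Field k] {V : Type u} [Quiver.{v} V] {W : Type u₁} [Quiver.{v₁} W]

variable (V) in
/-- Locally finite quivers: finitely many arrows start, resp. end, at each vertex. -/
def IsLocallyFiniteQuiver : Prop :=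
  ∀ x : V, Finite (Quiver.Star x) ∧ Finite (Quiver.Costar x)

variable (V) in
/-- Quivers which are connected as unoriented graphs. -/
def IsConnectedQuiver : Prop :=
  Nonempty V ∧ ∀ x y : V, Relation.ReflTransGen
    (fun a b : V => Nonempty (a ⟶ b) ∨ Nonempty (b ⟶ a)) x y

/-- Admissible ideals of `kQ`. The first condition says that `I` is contained in `(kQ⁺)²`, which
consists of the linear combinations of paths of length at least `2`. -/
structure IsAdmissible (I : CatIdeal k (PathCat k V)) : Prop where
  le_sq : ∀ (x y : PathCat k V) (r : x ⟶ y), r ∈ I.hom x y →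
    ∀ q ∈ (PathCat.coeffs r).support, 2 ≤ q.length
  long_paths : ∀ x : PathCat k V, ∃ n : ℕ, 2 ≤ n ∧ ∀ y : PathCat k V,
    (∀ q : Quiver.Path x.pt y.pt, n ≤ q.length → PathCat.ofPath q ∈ I.hom x y) ∧
    (∀ q : Quiver.Path y.pt x.pt, n ≤ q.length → PathCat.ofPath q ∈ I.hom y x)

/-- Minimal relations: nonzero elements `∑ tᵢ uᵢ` of `I`, none of whose nonempty proper
subsums lies in `I`. -/
def IsMinimalRelation (I : CatIdeal k (PathCat k V)) {x y : PathCat k V} (r : x ⟶ y) : Prop :=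
  r ∈ I.hom x y ∧ (PathCat.coeffs r).support.Nonempty ∧
    ∀ S : Finset (Quiver.Path x.pt y.pt), S.Nonempty → S ⊂ (PathCat.coeffs r).support →
      PathCat.ofCoeffs (∑ q ∈ S, Finsupp.single q (PathCat.coeffs r q)) ∉ I.hom x y

/-- The morphism of quivers `p` maps the ideal `J` into the ideal `I`. -/
def MapsIdeal (p : W ⥤q V) (J : CatIdeal k (PathCat k W)) (I : CatIdeal k (PathCat k V)) : Prop :=
  ∀ (x y : PathCat k W) (r : x ⟶ y), r ∈ J.hom x y →
    (PathCat.map k p).map r ∈ I.hom ((PathCat.map k p).obj x) ((PathCat.map k p).obj y)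

/-- Coverings `(W, J) → (V, I)` of quivers with relations. -/
structure IsBoundQuiverCovering (p : W ⥤q V) (J : CatIdeal k (PathCat k W))
    (I : CatIdeal k (PathCat k V)) : Prop where
  mapsIdeal : MapsIdeal p J I
  surjective : Function.Surjective p.obj
  bijective_star : ∀ x : W, Function.Bijective (p.star x)
  bijective_costar : ∀ x : W, Function.Bijective (p.costar x)
  lift_source : ∀ (x' : PathCat k W) (y : PathCat k V) (r : (PathCat.map k p).obj x' ⟶ y),
    IsMinimalRelation I r → ∃ (y' : PathCat k W) (hy : (PathCat.map k p).obj y' = y)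
      (r' : x' ⟶ y'), r' ∈ J.hom x' y' ∧ (PathCat.map k p).map r' ≫ eqToHom hy = r
  lift_target : ∀ (y' : PathCat k W) (x : PathCat k V) (r : x ⟶ (PathCat.map k p).obj y'),
    IsMinimalRelation I r → ∃ (x' : PathCat k W) (hx : (PathCat.map k p).obj x' = x)
      (r' : x' ⟶ y'), r' ∈ J.hom x' y' ∧ (PathCat.map k p).map r' = eqToHom hx ≫ r

/-- The functor `kQ'/I' ⥤ kQ/I` induced by a covering. -/
def IsBoundQuiverCovering.functor {p : W ⥤q V} {J : CatIdeal k (PathCat k W)}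
    {I : CatIdeal k (PathCat k V)} (hp : IsBoundQuiverCovering p J I) :
    IdealQuot J ⥤ IdealQuot I :=
  IdealQuot.map (PathCat.map k p) hp.mapsIdeal

/-- The covering `p` is a Galois covering with group `G`: both quivers are connected, and `G` is
identified with a group of automorphisms of `p` (automorphisms `g` of the quiver `W` with
`g(J) ⊆ J` and `p ∘ g = p`) acting transitively on each fibre. -/
def IsGaloisBoundQuiverCovering (G : Type u₃) [Group G] (p : W ⥤q V)
    (J : CatIdeal k (PathCat k W)) (I : CatIdeal k (PathCat k V)) : Prop :=
  IsBoundQuiverCovering p J I ∧ IsConnectedQuiver W ∧ IsConnectedQuiver V ∧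
    ∃ σ : G → (W ⥤q W), Function.Injective σ ∧ σ 1 = 𝟭q W ∧
      (∀ g h : G, σ (g * h) = σ h ⋙q σ g) ∧
      (∀ g : G, MapsIdeal (σ g) J J) ∧ (∀ g : G, σ g ⋙q p = p) ∧
      ∀ x y : W, p.obj x = p.obj y → ∃ g : G, (σ g).obj x = y

end BoundQuivers

/-! ### Isomorphisms, admissible presentations -/

/-- Isomorphisms of categories: functors bijective on objects and on morphisms. -/
structure IsIsoOfCategories {C : Type u₁} [Category.{v₁} C] {D : Type u₂} [Category.{v₂} D]
    (Φ : C ⥤ D) : Prop where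
  bijective_obj : Function.Bijective Φ.obj
  bijective_map : ∀ x y : C, Function.Bijective (fun f : x ⟶ y => Φ.map f)

/-- `φ : kQ/I ⥤ C` is an admissible presentation of `C`, where `Q` is the quiver with arrows
`A x y`: the quiver `Q` is locally finite and is the ordinary quiver of `C`, the ideal `I` is
admissible and `φ` is an isomorphism of `k`-categories. -/
structure IsAdmissiblePresentation {k : Type w} [Field k] {C : Type u} [Category.{v} C]
    [Preadditive C] [Linear k C] {A : C → C → Type v₁} {I : CatIdeal k (PathCat k (Vert A))}
    (φ : IdealQuot I ⥤ C) : Prop where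
  locallyFinite : IsLocallyFiniteQuiver (Vert A)
  ordinary : IsOrdinaryQuiver k A
  admissible : IsAdmissible I
  additive : φ.Additive
  linear : φ.Linear k
  isIso : IsIsoOfCategories φ

/-! ### Group actions, quotient categories, Galois coverings -/

/-- The structure of a free `G`-category on the `k`-category `E`: a morphism from `G` to the group
of (strict, `k`-linear) automorphisms of `E`, such that the action on objects is free. -/
structure FreeGCategory (k : Type w) [Field k] (G : Type u₃) [Group G] (E : Type u)
    [Category.{v} E] [Preadditive E] [Linear k E] where
  act : G → E ⥤ E
  act_one : act 1 = 𝟭 E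
  act_mul : ∀ g h : G, act (g * h) = act h ⋙ act g
  additive : ∀ g : G, (act g).Additive
  linear : ∀ g : G, (act g).Linear k
  free : ∀ (g : G) (x : E), (act g).obj x = x → g = 1

namespace FreeGCategory

variable {k : Type w} [Field k] {G : Type u₃} [Group G] {E : Type u}
  [Category.{v} E] [Preadditive E] [Linear k E] (ρ : FreeGCategory k G E)

instance (g : G) : (ρ.act g).Additive := ρ.additive g

instance (g : G) : (ρ.act g).Linear k := ρ.linear g

theorem mul_obj (g h : G) (x : E) :
    (ρ.act (g * h)).obj x = (ρ.act g).obj ((ρ.act h).obj x) := by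
  rw [ρ.act_mul]; rfl

theorem one_obj (x : E) : (ρ.act 1).obj x = x := by
  rw [ρ.act_one]; rfl

theorem inv_obj (g : G) (x : E) : (ρ.act g⁻¹).obj ((ρ.act g).obj x) = x := by
  rw [← ρ.mul_obj, inv_mul_cancel, ρ.one_obj]

theorem eq_of_obj_eq {g h : G} {x : E} (e : (ρ.act g).obj x = (ρ.act h).obj x) : g = h := by
  have h1 : h⁻¹ * g = 1 := ρ.free _ x (by rw [ρ.mul_obj, e, ρ.inv_obj])
  exact (inv_mul_eq_one.1 h1).symm

/-- Two objects are equivalent when they lie in the same orbit. -/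
def setoid : Setoid E where
  r x y := ∃ g : G, (ρ.act g).obj x = y
  iseqv :=
    { refl := fun x => ⟨1, ρ.one_obj x⟩
      symm := by
        rintro x _ ⟨g, rfl⟩
        exact ⟨g⁻¹, ρ.inv_obj g x⟩
      trans := by
        rintro x _ _ ⟨g, rfl⟩ ⟨h, rfl⟩
        exact ⟨h * g, ρ.mul_obj h g x⟩ }

/-- Objects of the quotient category `E/G`: the orbits of objects of `E`. -/
structure OrbitCat where
  orbit : Quotient ρ.setoid

/-- The orbit of an object. -/
def toOrbit (x : E) : ρ.OrbitCat := ⟨Quotient.mk ρ.setoid x⟩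

theorem toOrbit_obj (g : G) (x : E) : ρ.toOrbit ((ρ.act g).obj x) = ρ.toOrbit x :=
  congrArg OrbitCat.mk (Quotient.sound (s := ρ.setoid) ⟨g⁻¹, ρ.inv_obj g x⟩)

theorem exists_of_toOrbit_eq {x y : E} (h : ρ.toOrbit x = ρ.toOrbit y) : ∃ g : G, (ρ.act g).obj x = y :=
  Quotient.exact (s := ρ.setoid) (congrArg OrbitCat.orbit h)

theorem toOrbit_surjective (α : ρ.OrbitCat) : ∃ x, ρ.toOrbit x = α := by
  obtain ⟨⟨x⟩⟩ := α
  exact ⟨x, rfl⟩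

/-- The pairs of objects in a given pair of orbits. -/
abbrev Pairs (α β : ρ.OrbitCat) := {q : E × E // ρ.toOrbit q.1 = α ∧ ρ.toOrbit q.2 = β}

open Classical in
/-- The direct sum of the morphism spaces from objects in `α` to objects in `β`. -/
abbrev SumHom (α β : ρ.OrbitCat) := DirectSum (ρ.Pairs α β) fun q => (q.1.1 ⟶ q.1.2)

open Classical in
/-- The inclusion of a morphism space in the direct sum. -/
def incl {α β : ρ.OrbitCat} {x y : E} (hx : ρ.toOrbit x = α) (hy : ρ.toOrbit y = β) :
    (x ⟶ y) →ₗ[k] ρ.SumHom α β :=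
  DirectSum.lof k (ρ.Pairs α β) (fun q => (q.1.1 ⟶ q.1.2)) ⟨(x, y), hx, hy⟩

/-- The subspace spanned by the differences `g u - u`. -/
def relations (α β : ρ.OrbitCat) : Submodule k (ρ.SumHom α β) :=
  Submodule.span k {d | ∃ (g : G) (x y : E) (hx : ρ.toOrbit x = α) (hy : ρ.toOrbit y = β) (u : x ⟶ y),
    d = ρ.incl ((ρ.toOrbit_obj g x).trans hx) ((ρ.toOrbit_obj g y).trans hy) ((ρ.act g).map u) -
      ρ.incl hx hy u}

/-- The morphism space `(⨁ E(x,y)) / G` from `α` to `β` in the quotient category. -/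
abbrev QuotHom (α β : ρ.OrbitCat) := ρ.SumHom α β ⧸ ρ.relations α β

/-- The class in `E/G` of a morphism of `E`. -/
def cls {α β : ρ.OrbitCat} {x y : E} (hx : ρ.toOrbit x = α) (hy : ρ.toOrbit y = β) :
    (x ⟶ y) →ₗ[k] ρ.QuotHom α β :=
  (ρ.relations α β).mkQ ∘ₗ ρ.incl hx hy

theorem cls_act {α β : ρ.OrbitCat} {x y : E} (hx : ρ.toOrbit x = α) (hy : ρ.toOrbit y = β) (g : G)
    (hx' : ρ.toOrbit ((ρ.act g).obj x) = α) (hy' : ρ.toOrbit ((ρ.act g).obj y) = β) (u : x ⟶ y) :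
    ρ.cls hx' hy' ((ρ.act g).map u) = ρ.cls hx hy u :=
  (Submodule.Quotient.eq _).2 (Submodule.subset_span ⟨g, x, y, hx, hy, u, rfl⟩)

open Classical in
theorem linearMap_ext {M : Type*} [AddCommGroup M] [Module k M] {α β : ρ.OrbitCat}
    {f f' : ρ.QuotHom α β →ₗ[k] M}
    (h : ∀ (x y : E) (hx : ρ.toOrbit x = α) (hy : ρ.toOrbit y = β) (u : x ⟶ y),
      f (ρ.cls hx hy u) = f' (ρ.cls hx hy u)) : f = f' := by
  apply Submodule.linearMap_qext
  apply DirectSum.linearMap_ext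
  rintro ⟨⟨x, y⟩, hx, hy⟩
  ext u
  exact h x y hx hy u

/-- The element of `G` which moves `y` to `y'`. -/
def mover {y y' : E} (h : ρ.toOrbit y = ρ.toOrbit y') : G := (ρ.exists_of_toOrbit_eq h).choose

theorem mover_obj {y y' : E} (h : ρ.toOrbit y = ρ.toOrbit y') : (ρ.act (ρ.mover h)).obj y = y' :=
  (ρ.exists_of_toOrbit_eq h).choose_spec

/-- The composition of the classes of `u : x ⟶ y` and `v : y' ⟶ z`, where `y` and `y'` lie in the
same orbit: the class of `g u ≫ v`, where `g` is the element of `G` moving `y` to `y'`. -/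
def compGen {α β γ : ρ.OrbitCat} {x y y' z : E} (hx : ρ.toOrbit x = α) (hy : ρ.toOrbit y = β)
    (hy' : ρ.toOrbit y' = β) (hz : ρ.toOrbit z = γ) :
    (x ⟶ y) →ₗ[k] (y' ⟶ z) →ₗ[k] ρ.QuotHom α γ :=
  ((Linear.comp _ _ _).compr₂
    (ρ.cls ((ρ.toOrbit_obj (ρ.mover (hy.trans hy'.symm)) x).trans hx) hz)).comp
    ((Linear.rightComp k _ (eqToHom (ρ.mover_obj (hy.trans hy'.symm)))).comp
      ((ρ.act (ρ.mover (hy.trans hy'.symm))).mapLinearMap k))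

theorem compGen_act {α β γ : ρ.OrbitCat} {x y z : E} (hx : ρ.toOrbit x = α) (hy : ρ.toOrbit y = β) (g : G)
    (hy' : ρ.toOrbit ((ρ.act g).obj y) = β) (hz : ρ.toOrbit z = γ) (u : x ⟶ y)
    (v : (ρ.act g).obj y ⟶ z) :
    ρ.compGen hx hy hy' hz u v =
      ρ.cls ((ρ.toOrbit_obj g x).trans hx) hz ((ρ.act g).map u ≫ v) := by
  have key : ∀ (g' : G) (e : (ρ.act g').obj y = (ρ.act g).obj y),
      ρ.cls ((ρ.toOrbit_obj g' x).trans hx) hz (((ρ.act g').map u ≫ eqToHom e) ≫ v) =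
        ρ.cls ((ρ.toOrbit_obj g x).trans hx) hz ((ρ.act g).map u ≫ v) := by
    intro g' e
    obtain rfl := ρ.eq_of_obj_eq e
    rw [eqToHom_refl, Category.comp_id]
  exact key _ _

/-- Replacing a morphism by an equal one with propositionally equal source and target. -/
theorem cls_eqToHom {α β : ρ.OrbitCat} {x y x' y' : E} (hx : ρ.toOrbit x = α) (hy : ρ.toOrbit y = β)
    (ex : x' = x) (ey : y = y') (hx' : ρ.toOrbit x' = α) (hy' : ρ.toOrbit y' = β) (u : x ⟶ y) :
    ρ.cls hx' hy' (eqToHom ex ≫ u ≫ eqToHom ey) = ρ.cls hx hy u := by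
  subst ex ey
  simp

theorem map_mul (g h : G) {x y : E} (u : x ⟶ y) :
    (ρ.act (g * h)).map u = eqToHom (ρ.mul_obj g h x) ≫ (ρ.act g).map ((ρ.act h).map u) ≫
      eqToHom (ρ.mul_obj g h y).symm :=
  Functor.congr_hom (ρ.act_mul g h) u

theorem compGen_act_left {α β γ : ρ.OrbitCat} {x y y' z : E} (hx : ρ.toOrbit x = α) (hy : ρ.toOrbit y = β)
    (hy' : ρ.toOrbit y' = β) (hz : ρ.toOrbit z = γ) (g : G) (hgx : ρ.toOrbit ((ρ.act g).obj x) = α)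
    (hgy : ρ.toOrbit ((ρ.act g).obj y) = β) (u : x ⟶ y) (v : y' ⟶ z) :
    ρ.compGen hgx hgy hy' hz ((ρ.act g).map u) v = ρ.compGen hx hy hy' hz u v := by
  obtain ⟨h, rfl⟩ := ρ.exists_of_toOrbit_eq (hgy.trans hy'.symm)
  rw [compGen_act]
  have key : ∀ (t : E) (e : (ρ.act (h * g)).obj y = t) (ht : ρ.toOrbit t = β) (v : t ⟶ z),
      ρ.compGen hx hy ht hz u v = ρ.cls ((ρ.toOrbit_obj (h * g) x).trans hx) hz
        ((ρ.act (h * g)).map u ≫ eqToHom e ≫ v) := by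
    intro t e ht v
    subst e
    rw [compGen_act]
    simp
  rw [key _ (ρ.mul_obj h g y) hy' v, map_mul]
  have := ρ.cls_eqToHom ((ρ.toOrbit_obj h _).trans hgx) hz (ρ.mul_obj h g x) rfl
    ((ρ.toOrbit_obj (h * g) x).trans hx) hz ((ρ.act h).map ((ρ.act g).map u) ≫ v)
  rw [← this]
  simp

theorem compGen_act_right {α β γ : ρ.OrbitCat} {x y y' z : E} (hx : ρ.toOrbit x = α) (hy : ρ.toOrbit y = β)
    (hy' : ρ.toOrbit y' = β) (hz : ρ.toOrbit z = γ) (g : G) (hgy : ρ.toOrbit ((ρ.act g).obj y') = β)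
    (hgz : ρ.toOrbit ((ρ.act g).obj z) = γ) (u : x ⟶ y) (v : y' ⟶ z) :
    ρ.compGen hx hy hgy hgz u ((ρ.act g).map v) = ρ.compGen hx hy hy' hz u v := by
  obtain ⟨h, rfl⟩ := ρ.exists_of_toOrbit_eq (hy.trans hy'.symm)
  rw [compGen_act]
  have key : ∀ (t : E) (e : (ρ.act (g * h)).obj y = t) (ht : ρ.toOrbit t = β)
      (v : t ⟶ (ρ.act g).obj z),
      ρ.compGen hx hy ht hgz u v = ρ.cls ((ρ.toOrbit_obj (g * h) x).trans hx) hgz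
        ((ρ.act (g * h)).map u ≫ eqToHom e ≫ v) := by
    intro t e ht v
    subst e
    rw [compGen_act]
    simp
  rw [key _ (ρ.mul_obj g h y) hgy, map_mul]
  rw [← ρ.cls_act ((ρ.toOrbit_obj h x).trans hx) hz g ((ρ.toOrbit_obj g _).trans ((ρ.toOrbit_obj h x).trans hx))
    hgz, ← ρ.cls_eqToHom ((ρ.toOrbit_obj g _).trans ((ρ.toOrbit_obj h x).trans hx)) hgz
      (ρ.mul_obj g h x) rfl ((ρ.toOrbit_obj (g * h) x).trans hx) hgz]
  simp

open Classical in
/-- The composition, on direct sums. -/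
def preComp (α β γ : ρ.OrbitCat) : ρ.SumHom α β →ₗ[k] ρ.SumHom β γ →ₗ[k] ρ.QuotHom α γ :=
  DirectSum.toModule k _ _ fun q => LinearMap.flip <| DirectSum.toModule k _ _ fun q' =>
    LinearMap.flip <| ρ.compGen q.2.1 q.2.2 q'.2.1 q'.2.2

open Classical in
theorem preComp_incl {α β γ : ρ.OrbitCat} {x y y' z : E} (hx : ρ.toOrbit x = α) (hy : ρ.toOrbit y = β)
    (hy' : ρ.toOrbit y' = β) (hz : ρ.toOrbit z = γ) (u : x ⟶ y) (v : y' ⟶ z) :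
    ρ.preComp α β γ (ρ.incl hx hy u) (ρ.incl hy' hz v) = ρ.compGen hx hy hy' hz u v := by
  unfold preComp incl
  rw [DirectSum.toModule_lof, LinearMap.flip_apply, DirectSum.toModule_lof, LinearMap.flip_apply]

/-- The composition of the quotient category, induced by the composition of `E`. -/
def compHom (α β γ : ρ.OrbitCat) : ρ.QuotHom α β →ₗ[k] ρ.QuotHom β γ →ₗ[k] ρ.QuotHom α γ :=
  Submodule.liftQ _
    (LinearMap.flip <| Submodule.liftQ _ (LinearMap.flip <| ρ.preComp α β γ)
      (by
        refine Submodule.span_le.2 ?_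
        rintro _ ⟨g, y', z, hy', hz, v, rfl⟩
        rw [SetLike.mem_coe, LinearMap.mem_ker]
        classical
        apply DirectSum.linearMap_ext
        rintro ⟨⟨x, y⟩, hx, hy⟩
        ext u
        change ρ.preComp α β γ (ρ.incl hx hy u) _ = 0
        rw [map_sub, preComp_incl, preComp_incl,
          ρ.compGen_act_right hx hy hy' hz, sub_self]))
    (by
      refine Submodule.span_le.2 ?_
      rintro _ ⟨g, x, y, hx, hy, u, rfl⟩
      rw [SetLike.mem_coe, LinearMap.mem_ker]
      apply ρ.linearMap_ext
      intro y' z hy' hz v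
      change ρ.preComp α β γ _ (ρ.incl hy' hz v) = 0
      rw [LinearMap.map_sub₂, preComp_incl, preComp_incl,
        ρ.compGen_act_left hx hy hy' hz, sub_self])

theorem compHom_cls' {α β γ : ρ.OrbitCat} {x y y' z : E} (hx : ρ.toOrbit x = α) (hy : ρ.toOrbit y = β)
    (hy' : ρ.toOrbit y' = β) (hz : ρ.toOrbit z = γ) (u : x ⟶ y) (v : y' ⟶ z) :
    ρ.compHom α β γ (ρ.cls hx hy u) (ρ.cls hy' hz v) = ρ.compGen hx hy hy' hz u v :=
  ρ.preComp_incl hx hy hy' hz u v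

theorem compHom_cls {α β γ : ρ.OrbitCat} {x y z : E} (hx : ρ.toOrbit x = α) (hy : ρ.toOrbit y = β)
    (hy' : ρ.toOrbit y = β) (hz : ρ.toOrbit z = γ) (u : x ⟶ y) (v : y ⟶ z) :
    ρ.compHom α β γ (ρ.cls hx hy u) (ρ.cls hy' hz v) = ρ.cls hx hz (u ≫ v) := by
  rw [compHom_cls']
  have key : ∀ (t : E) (e : (ρ.act 1).obj y = t) (ht : ρ.toOrbit t = β) (v : t ⟶ z),
      ρ.compGen hx hy ht hz u v = ρ.cls ((ρ.toOrbit_obj 1 x).trans hx) hz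
        ((ρ.act 1).map u ≫ eqToHom e ≫ v) := by
    intro t e ht v
    subst e
    rw [compGen_act]
    simp
  rw [key _ (ρ.one_obj y), ← ρ.cls_eqToHom hx hz (ρ.one_obj x) rfl ((ρ.toOrbit_obj 1 x).trans hx) hz,
    Functor.congr_hom ρ.act_one u]
  simp

/-- The identity of an orbit: the class of the identity of any of its members. -/
def idHom (α : ρ.OrbitCat) : ρ.QuotHom α α :=
  ρ.cls (ρ.toOrbit_surjective α).choose_spec (ρ.toOrbit_surjective α).choose_spec (𝟙 _)

theorem cls_id {α : ρ.OrbitCat} {x : E} (hx : ρ.toOrbit x = α) : ρ.cls hx hx (𝟙 x) = ρ.idHom α := by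
  obtain ⟨g, hg⟩ := ρ.exists_of_toOrbit_eq (hx.trans (ρ.toOrbit_surjective α).choose_spec.symm)
  have key : ∀ (y : E) (hy : ρ.toOrbit y = α), (ρ.act g).obj x = y →
      ρ.cls hx hx (𝟙 x) = ρ.cls hy hy (𝟙 y) := by
    rintro _ hy rfl
    rw [← ρ.cls_act hx hx g hy hy, CategoryTheory.Functor.map_id]
  exact key _ _ hg

theorem idHom_comp (α β : ρ.OrbitCat) : ρ.compHom α α β (ρ.idHom α) = LinearMap.id := by
  apply ρ.linearMap_ext
  intro x y hx hy u
  rw [← ρ.cls_id hx, compHom_cls, Category.id_comp, LinearMap.id_apply]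

theorem comp_idHom (α β : ρ.OrbitCat) : (ρ.compHom α β β).flip (ρ.idHom β) = LinearMap.id := by
  apply ρ.linearMap_ext
  intro x y hx hy u
  rw [← ρ.cls_id hy, LinearMap.flip_apply, compHom_cls, Category.comp_id, LinearMap.id_apply]

/-- Every class of a morphism is the class of a morphism with prescribed source in the orbit. -/
theorem exists_cls_eq {β γ : ρ.OrbitCat} {y y' z : E} (hy : ρ.toOrbit y = β) (hy' : ρ.toOrbit y' = β)
    (hz : ρ.toOrbit z = γ) (v : y' ⟶ z) :
    ∃ (z' : E) (hz' : ρ.toOrbit z' = γ) (v' : y ⟶ z'), ρ.cls hy' hz v = ρ.cls hy hz' v' := by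
  obtain ⟨g, rfl⟩ := ρ.exists_of_toOrbit_eq (hy'.trans hy.symm)
  exact ⟨_, (ρ.toOrbit_obj g z).trans hz, (ρ.act g).map v, (ρ.cls_act hy' hz g _ _ v).symm⟩

theorem assocHom (α β γ δ : ρ.OrbitCat) (f : ρ.QuotHom α β) (g : ρ.QuotHom β γ)
    (h : ρ.QuotHom γ δ) :
    ρ.compHom α γ δ (ρ.compHom α β γ f g) h = ρ.compHom α β δ f (ρ.compHom β γ δ g h) := by
  have h4 : ((ρ.compHom α γ δ).flip h).comp ((ρ.compHom α β γ).flip g) =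
      (ρ.compHom α β δ).flip (ρ.compHom β γ δ g h) := by
    apply ρ.linearMap_ext
    intro x y hx hy u
    have h3 : ((ρ.compHom α γ δ).flip h).comp (ρ.compHom α β γ (ρ.cls hx hy u)) =
        (ρ.compHom α β δ (ρ.cls hx hy u)).comp ((ρ.compHom β γ δ).flip h) := by
      apply ρ.linearMap_ext
      intro y' z hy' hz v
      have h2 : ρ.compHom α γ δ (ρ.compHom α β γ (ρ.cls hx hy u) (ρ.cls hy' hz v)) =
          (ρ.compHom α β δ (ρ.cls hx hy u)).comp (ρ.compHom β γ δ (ρ.cls hy' hz v)) := by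
        apply ρ.linearMap_ext
        intro z' t hz' ht w
        obtain ⟨z₁, hz₁, v, e⟩ := ρ.exists_cls_eq hy hy' hz v
        obtain ⟨t₁, ht₁, w, e'⟩ := ρ.exists_cls_eq hz₁ hz' ht w
        rw [e, e', LinearMap.comp_apply]
        simp only [compHom_cls, Category.assoc]
      exact LinearMap.congr_fun h2 h
    exact LinearMap.congr_fun h3 g
  exact LinearMap.congr_fun h4 f

/-- The quotient category `E/G`. -/
instance : Category ρ.OrbitCat where
  Hom α β := ρ.QuotHom α β
  id α := ρ.idHom α
  comp f g := ρ.compHom _ _ _ f g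
  id_comp f := congrArg (fun F => F f) (ρ.idHom_comp _ _)
  comp_id f := congrArg (fun F => F f) (ρ.comp_idHom _ _)
  assoc f g h := ρ.assocHom _ _ _ _ f g h

instance (x y : ρ.OrbitCat) : AddCommGroup (x ⟶ y) :=
  inferInstanceAs (AddCommGroup (ρ.QuotHom x y))

instance (x y : ρ.OrbitCat) : Module k (x ⟶ y) :=
  inferInstanceAs (Module k (ρ.QuotHom x y))

instance : Preadditive ρ.OrbitCat where
  homGroup _ _ := inferInstance
  add_comp _ _ _ f f' g := LinearMap.map_add₂ (ρ.compHom _ _ _) f f' g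
  comp_add _ _ _ f g g' := map_add (ρ.compHom _ _ _ f) g g'

instance : Linear k ρ.OrbitCat where
  homModule _ _ := inferInstance
  smul_comp _ _ _ a f g := LinearMap.map_smul₂ (ρ.compHom _ _ _) a f g
  comp_smul _ _ _ f a g := map_smul (ρ.compHom _ _ _ f) a g

/-- The natural projection `E ⥤ E/G`. -/
def proj : E ⥤ ρ.OrbitCat where
  obj x := ρ.toOrbit x
  map {x y} u := ρ.cls (rfl : ρ.toOrbit x = ρ.toOrbit x) (rfl : ρ.toOrbit y = ρ.toOrbit y) u
  map_id _ := ρ.cls_id rfl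
  map_comp u v := (ρ.compHom_cls rfl rfl rfl rfl u v).symm

end FreeGCategory

/-- `F : E ⥤ B` is a Galois covering with group `G`, for the given structure `ρ` of a free
`G`-category on `E`: it is the projection `E ⥤ E/G` followed by an isomorphism of
`k`-categories. -/
def IsGaloisCovering {k : Type w} [Field k] {G : Type u₃} [Group G]
    {E : Type u₁} [Category.{v₁} E] [Preadditive E] [Linear k E]
    {B : Type u₂} [Category.{v₂} B] [Preadditive B] [Linear k B]
    (ρ : FreeGCategory k G E) (F : E ⥤ B) : Prop :=
  ∃ Φ : ρ.OrbitCat ⥤ B, Φ.Additive ∧ Φ.Linear k ∧ IsIsoOfCategories Φ ∧ ρ.proj ⋙ Φ = F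

end

-- Because `G` acts freely on objects, a Galois covering `F : E ⥤ B` splits each space `B(F x, c)`
-- as the direct sum of the spaces `E(x, y)`, with `y` running through the fibre of `c`.
-- `CoveringDecomposition` records this splitting, and its projections `comp` onto the summands
-- drive the whole argument.
--
-- Both `F` and the projections respect the radical and its square: distinct objects of `E` are not
-- isomorphic, so a summand `E(x, y)` with `y ≠ x` lies in the radical, and on the remaining summand
-- `F` reflects isomorphisms. Hence the radical of `B` modulo its square is spanned by classes of
-- homogeneous morphisms `F f`, and a basis of such morphisms can be chosen
-- (`exists_homogeneous_arrowBasis`). Transitivity of `G` on the fibres lets each chosen arrow be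
-- lifted at any prescribed source or target, uniquely by directness of the sum; the lifts form a
-- basis of the radical of `E` modulo its square (`isArrowBasis_liftArr`).
--
-- In any locally bounded category, such a basis yields an admissible presentation
-- (`IsArrowBasis.isAdmissiblePresentation`). The radical is locally nilpotent by Nakayama's lemma,
-- and endomorphisms are scalars modulo the radical since `k` is algebraically closed, so evaluation
-- of paths is surjective; independence of the arrows modulo the square of the radical makes its
-- kernel admissible. With lifted arrows upstairs, the two evaluations commute with the covering of
-- quivers.
--
-- There remain the minimal relations. Keeping only the paths of a relation that lift to paths from
-- `x` to `y` corresponds, after evaluation, to applying `comp` (`lift_map_restrict`), so the part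
-- kept is again a relation. By minimality, it is the whole relation as soon as it is nonzero.

universe v₃

noncomputable section

/-! ### Morphisms of locally bounded categories -/

namespace IsLocallyBounded

section Split

variable {k : Type w} [Field k] {C : Type u} [Category.{v} C] [Preadditive C] [Linear k C]

theorem id_ne_zero (hC : IsLocallyBounded k C) (x : C) : 𝟙 x ≠ 0 := by
  have := hC.isLocalRing_end x
  exact one_ne_zero (α := End x)

theorem isIso_or_isIso_id_sub (hC : IsLocallyBounded k C) {x : C} (f : x ⟶ x) :
    IsIso f ∨ IsIso (𝟙 x - f) := by
  have := hC.isLocalRing_end x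
  have h := IsLocalRing.isUnit_or_isUnit_of_add_one (R := End x) (a := f) (b := 𝟙 x - f)
    (add_sub_cancel (G := x ⟶ x) f (𝟙 x))
  exact h.imp (isUnit_iff_isIso f).1 (isUnit_iff_isIso (𝟙 x - f)).1

/-- In a locally bounded category, every morphism with a right inverse is invertible. -/
theorem isIso_of_comp_eq_id (hC : IsLocallyBounded k C) {x y : C} {f : x ⟶ y} {h : y ⟶ x}
    (e : f ≫ h = 𝟙 x) : IsIso f := by
  have idem : (h ≫ f) ≫ h ≫ f = h ≫ f := by
    rw [Category.assoc, reassoc_of% e]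
  rcases hC.isIso_or_isIso_id_sub (h ≫ f) with hi | hi
  · refine ⟨h, e, ?_⟩
    rw [← cancel_epi (h ≫ f), idem, Category.comp_id]
  · have h0 : h ≫ f = 0 := by
      rw [← cancel_mono (𝟙 y - h ≫ f), Preadditive.comp_sub, idem, Category.comp_id, sub_self,
        Limits.zero_comp]
    have : 𝟙 x = 0 := by
      rw [← e, ← Category.id_comp f, ← e, Category.assoc, Category.assoc, reassoc_of% h0,
        Limits.zero_comp, Limits.comp_zero]
    exact absurd this (hC.id_ne_zero x)

theorem comp_mem_radical (hC : IsLocallyBounded k C) {x y z : C} {f : x ⟶ y}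
    (hf : f ∈ radical k x y) (g : y ⟶ z) :
    f ≫ g ∈ radical k x z := by
  rw [mem_radical_iff hC] at hf ⊢
  intro h
  exact hf (hC.isIso_of_comp_eq_id (h := g ≫ inv (f ≫ g))
    (by rw [← Category.assoc, IsIso.hom_inv_id]))

theorem mem_radical_comp (hC : IsLocallyBounded k C) {x y z : C} (f : x ⟶ y) {g : y ⟶ z}
    (hg : g ∈ radical k y z) :
    f ≫ g ∈ radical k x z := by
  rw [mem_radical_iff hC] at hg ⊢
  intro h
  have e : (inv (f ≫ g) ≫ f) ≫ g = 𝟙 z := by rw [Category.assoc, IsIso.inv_hom_id]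
  have := hC.isIso_of_comp_eq_id e
  have hi : IsIso ((inv (f ≫ g) ≫ f) ≫ g) := by rw [e]; infer_instance
  exact hg (IsIso.of_isIso_comp_left (inv (f ≫ g) ≫ f) g)

theorem id_notMem_radical (hC : IsLocallyBounded k C) (x : C) : 𝟙 x ∉ radical k x x := by
  rw [mem_radical_iff hC]
  exact fun h => h inferInstance

/-- Finitely many generators of the direct sum have finite supports; a component outside their union
vanishes on the generators, hence everywhere. -/
theorem exists_finset_source (hC : IsLocallyBounded k C) (x : C) : ∃ S : Finset C, ∀ y, ∀ f :
    x ⟶ y, f ≠ 0 → y ∈ S := by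
  classical
  obtain ⟨T, hT⟩ := (hC.finite_source x).fg_top
  refine ⟨T.biUnion fun t => DFinsupp.support t, fun y f hf => ?_⟩
  by_contra hy
  have h0 : DirectSum.component k C (fun y => (x ⟶ y)) y = 0 := by
    refine LinearMap.ext_on hT fun t ht => ?_
    by_contra h
    exact hy (Finset.mem_biUnion.2 ⟨t, ht, DFinsupp.mem_support_iff.2 h⟩)
  have := LinearMap.congr_fun h0 (DirectSum.lof k C (fun y => (x ⟶ y)) y f)
  rw [DirectSum.component.lof_self] at this
  exact hf this

theorem exists_finset_target (hC : IsLocallyBounded k C) (y : C) : ∃ S : Finset C, ∀ x, ∀ f :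
    x ⟶ y, f ≠ 0 → x ∈ S := by
  classical
  obtain ⟨T, hT⟩ := (hC.finite_target y).fg_top
  refine ⟨T.biUnion fun t => DFinsupp.support t, fun x f hf => ?_⟩
  by_contra hx
  have h0 : DirectSum.component k C (fun x => (x ⟶ y)) x = 0 := by
    refine LinearMap.ext_on hT fun t ht => ?_
    by_contra h
    exact hx (Finset.mem_biUnion.2 ⟨t, ht, DFinsupp.mem_support_iff.2 h⟩)
  have := LinearMap.congr_fun h0 (DirectSum.lof k C (fun x => (x ⟶ y)) x f)
  rw [DirectSum.component.lof_self] at this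
  exact hf this

theorem finite_hom (hC : IsLocallyBounded k C) (x y : C) : Module.Finite k (x ⟶ y) := by
  classical
  have := hC.finite_source x
  exact Module.Finite.of_surjective (DirectSum.component k C (fun y => (x ⟶ y)) y)
    fun f => ⟨DirectSum.lof k C (fun y => (x ⟶ y)) y f, DirectSum.component.lof_self ..⟩

/-- Take for `c` an eigenvalue of `f`, which exists in a finite dimensional algebra. Algebraic
closedness of `k` enters the proof only through this lemma. -/
theorem exists_sub_smul_id_mem_radical (hC : IsLocallyBounded k C) [IsAlgClosed k] {x : C}
    (f : x ⟶ x) :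
    ∃ c : k, f - c • 𝟙 x ∈ radical k x x := by
  have := hC.isLocalRing_end x
  have : FiniteDimensional k (End x) := hC.finite_hom x x
  obtain ⟨c, hc⟩ := spectrum.nonempty_of_isAlgClosed_of_finiteDimensional k (End.of f)
  refine ⟨c, (mem_radical_iff hC _).2 fun h => hc ?_⟩
  rw [spectrum.mem_resolventSet_iff, Algebra.algebraMap_eq_smul_one, ← IsUnit.neg_iff, neg_sub]
  exact (isUnit_iff_isIso (f - c • 𝟙 x)).2 h

theorem mem_radical_of_ne (hC : IsLocallyBounded k C) {x y : C} (h : x ≠ y) (f : x ⟶ y) :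
    f ∈ radical k x y := by
  rw [mem_radical_iff hC]
  exact fun _ => h (hC.eq_of_iso x y ⟨asIso f⟩)

end Split
end IsLocallyBounded

/-! ### Powers of the radical -/

section RadPow
variable (k : Type w) [Field k] {C : Type u} [Category.{v} C] [Preadditive C] [Linear k C]

/-- The powers of the radical. -/
def radPow : ℕ → ∀ x y : C, Submodule k (x ⟶ y)
  | 0, _, _ => ⊤
  | n + 1, x, y => Submodule.span k {h | ∃ (z : C) (f : x ⟶ z) (g : z ⟶ y),
      f ∈ radPow n x z ∧ g ∈ radical k z y ∧ h = f ≫ g}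

variable {k}

theorem comp_mem_radPow_succ {n : ℕ} {x y z : C} {f : x ⟶ y} {g : y ⟶ z} (hf : f ∈ radPow k n x y)
    (hg : g ∈ radical k y z) : f ≫ g ∈ radPow k (n + 1) x z :=
  Submodule.subset_span ⟨y, f, g, hf, hg, rfl⟩

theorem radPow_succ_le_of_le {n m : ℕ} {x : C} (h : ∀ y : C, radPow k n x y ≤ radPow k m x y)
    (y : C) : radPow k (n + 1) x y ≤ radPow k (m + 1) x y := by
  refine Submodule.span_le.2 ?_
  rintro _ ⟨z, f, g, hf, hg, rfl⟩
  exact comp_mem_radPow_succ (h z hf) hg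

theorem radPow_succ_le (n : ℕ) (x y : C) : radPow k (n + 1) x y ≤ radPow k n x y := by
  induction n generalizing y with
  | zero => exact le_top
  | succ n ih => exact radPow_succ_le_of_le ih y

theorem radPow_antitone (x y : C) : Antitone fun n => radPow k n x y :=
  antitone_nat_of_succ_le fun n => radPow_succ_le n x y

theorem radPow_one_eq (hC : IsLocallyBounded k C) (x y : C) : radPow k 1 x y = radical k x y := by
  refine le_antisymm (Submodule.span_le.2 ?_) fun f hf => ?_
  · rintro _ ⟨z, f, g, -, hg, rfl⟩
    exact hC.mem_radical_comp f hg
  · rw [← Category.id_comp f]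
    exact comp_mem_radPow_succ (n := 0) (Submodule.mem_top (x := 𝟙 x)) hf

theorem radPow_two_eq (hC : IsLocallyBounded k C) (x y : C) :
    radPow k 2 x y = radicalSq k x y := by
  unfold radicalSq
  simp_rw [← radPow_one_eq hC x]
  rfl

/-- A finitely generated right ideal `M` of morphisms starting at `x` with `M ≤ M R` is zero. -/
theorem eq_bot_of_le_comp_radical (hC : IsLocallyBounded k C) {x : C}
    (M : ∀ y : C, Submodule k (x ⟶ y))
    (hM : ∀ y, M y ≤ Submodule.span k {h | ∃ (z : C) (f : x ⟶ z) (g : z ⟶ y),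
      f ∈ M z ∧ g ∈ radical k z y ∧ h = f ≫ g})
    (T : Finset (Σ y : C, (x ⟶ y)))
    (hT : ∀ y, M y ≤ Submodule.span k {h | ∃ t ∈ T, ∃ g : t.1 ⟶ y, h = t.2 ≫ g})
    (hTM : ∀ t ∈ T, t.2 ∈ M t.1) (y : C) : M y = ⊥ := by
  classical
  -- Nakayama's lemma: the generators are shown to be superfluous one at a time.
  induction T using Finset.induction_on with
  | empty => simpa using hT y
  | insert m T hm ih =>
    refine ih (fun y => (hT y).trans ?_) fun t ht => hTM t (Finset.mem_insert_of_mem ht)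
    have absorb : ∀ {z z' : C} (f : x ⟶ z) (g : z ⟶ z'),
        f ∈ Submodule.span k {h | ∃ t ∈ T, ∃ g : t.1 ⟶ z, h = t.2 ≫ g} →
        f ≫ g ∈ Submodule.span k {h | ∃ t ∈ T, ∃ g : t.1 ⟶ z', h = t.2 ≫ g} := by
      intro z z' f g hf
      induction hf using Submodule.span_induction with
      | mem f hf =>
        obtain ⟨t, ht, f, rfl⟩ := hf
        exact Submodule.subset_span ⟨t, ht, f ≫ g, by simp⟩
      | zero => simp
      | add f f' _ _ h h' => rw [Preadditive.add_comp]; exact add_mem h h'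
      | smul a f _ h => rw [Linear.smul_comp]; exact Submodule.smul_mem _ _ h
    -- Modulo the contribution of `T`, the elements of `M m.1` are `m.2 ≫ r` with `r` radical:
    -- expand along `M ≤ M R`, then along the generators.
    have key : ∀ f ∈ M m.1, ∃ r ∈ radical k m.1 m.1,
        f - m.2 ≫ r ∈ Submodule.span k {h | ∃ t ∈ T, ∃ g : t.1 ⟶ m.1, h = t.2 ≫ g} := by
      intro f hf
      replace hf := hM _ hf
      induction hf using Submodule.span_induction with
      | mem f hf =>
        obtain ⟨z, f, g, hf, hg, rfl⟩ := hf
        replace hf := hT _ hf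
        induction hf using Submodule.span_induction with
        | mem f hf =>
          obtain ⟨t, ht, f', rfl⟩ := hf
          rcases Finset.mem_insert.1 ht with rfl | ht
          · exact ⟨f' ≫ g, hC.mem_radical_comp f' hg, by simp⟩
          · exact ⟨0, zero_mem _, by
              rw [Limits.comp_zero, sub_zero, Category.assoc]
              exact Submodule.subset_span ⟨t, ht, f' ≫ g, rfl⟩⟩
        | zero => exact ⟨0, zero_mem _, by simp⟩
        | add f f' _ _ h h' =>
          obtain ⟨r, hr, h⟩ := h
          obtain ⟨r', hr', h'⟩ := h'
          refine ⟨r + r', add_mem hr hr', ?_⟩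
          rw [Preadditive.add_comp, Preadditive.comp_add, add_sub_add_comm]
          exact add_mem h h'
        | smul a f _ h =>
          obtain ⟨r, hr, h⟩ := h
          refine ⟨a • r, Submodule.smul_mem _ _ hr, ?_⟩
          rw [Linear.smul_comp, Linear.comp_smul, ← smul_sub]
          exact Submodule.smul_mem _ _ h
      | zero => exact ⟨0, zero_mem _, by simp⟩
      | add f f' _ _ h h' =>
        obtain ⟨r, hr, h⟩ := h
        obtain ⟨r', hr', h'⟩ := h'
        refine ⟨r + r', add_mem hr hr', ?_⟩
        rw [Preadditive.comp_add, add_sub_add_comm]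
        exact add_mem h h'
      | smul a f _ h =>
        obtain ⟨r, hr, h⟩ := h
        refine ⟨a • r, Submodule.smul_mem _ _ hr, ?_⟩
        rw [Linear.comp_smul, ← smul_sub]
        exact Submodule.smul_mem _ _ h
    -- For the generator itself, `m.2 ≫ (𝟙 - r)` comes from `T`, and `𝟙 - r` is invertible because
    -- the endomorphism ring is local.
    obtain ⟨r, hr, h⟩ := key m.2 (hTM m (Finset.mem_insert_self _ _))
    have hiso : IsIso (𝟙 m.1 - r) :=
      (hC.isIso_or_isIso_id_sub r).resolve_left ((mem_radical_iff hC r).1 hr)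
    have hmT : m.2 ∈ Submodule.span k {h | ∃ t ∈ T, ∃ g : t.1 ⟶ m.1, h = t.2 ≫ g} := by
      have := absorb _ (inv (𝟙 m.1 - r)) h
      rwa [show m.2 - m.2 ≫ r = m.2 ≫ (𝟙 m.1 - r) by simp [Preadditive.comp_sub],
        Category.assoc, IsIso.hom_inv_id, Category.comp_id] at this
    refine Submodule.span_le.2 ?_
    rintro _ ⟨t, ht, g, rfl⟩
    rcases Finset.mem_insert.1 ht with rfl | ht
    · exact absorb _ g hmT
    · exact Submodule.subset_span ⟨t, ht, g, rfl⟩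

/-- The radical of a locally bounded category is locally nilpotent. -/
theorem exists_radPow_eq_bot (hC : IsLocallyBounded k C) (x : C) :
    ∃ n, ∀ y, radPow k n x y = ⊥ := by
  classical
  obtain ⟨S, hS⟩ := hC.exists_finset_source x
  have hfin := fun y => hC.finite_hom x y
  -- Only the objects of `S` receive nonzero morphisms from `x`, so the total dimension of the
  -- `n`-th power is finite and non-increasing in `n`; the powers stop decreasing where it attains
  -- its minimum.
  obtain ⟨n, hn⟩ : ∃ n, ∀ y, radPow k (n + 1) x y = radPow k n x y := by
    have hd : Antitone fun n => ∑ y ∈ S, Module.finrank k (radPow k n x y) := fun n m h =>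
      Finset.sum_le_sum fun y _ => Submodule.finrank_mono (radPow_antitone x y h)
    let d := fun n => ∑ y ∈ S, Module.finrank k (radPow k n x y)
    refine ⟨Function.argmin d, fun y => ?_⟩
    by_cases hy : y ∈ S
    · refine Submodule.eq_of_le_of_finrank_eq (radPow_succ_le _ x y) ?_
      refine (Finset.sum_eq_sum_iff_of_le fun y _ =>
        Submodule.finrank_mono (radPow_succ_le _ x y)).1 ?_ y hy
      exact le_antisymm (hd (Nat.le_succ _)) (Function.argmin_le d _)
    · ext f
      have : f = 0 := by
        by_contra h
        exact hy (hS y f h)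
      simp [this]
  refine ⟨n, fun y => ?_⟩
  have hfg : ∀ y, ∃ T : Finset (x ⟶ y), Submodule.span k (T : Set (x ⟶ y)) = radPow k n x y :=
    fun y => (IsNoetherian.noetherian (radPow k n x y))
  choose T hT using hfg
  -- The stable power `M` satisfies `M = M R` and is finitely generated, so Nakayama applies.
  refine eq_bot_of_le_comp_radical hC (radPow k n x) (fun y => (hn y).ge)
    (S.sigma fun y => T y) (fun y => ?_) (fun t ht => ?_) y
  · by_cases hy : y ∈ S
    · rw [← hT y]
      exact Submodule.span_mono fun f hf =>
        ⟨⟨y, f⟩, Finset.mem_sigma.2 ⟨hy, hf⟩, 𝟙 y, (Category.comp_id f).symm⟩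
    · intro f _
      have : f = 0 := by
        by_contra h
        exact hy (hS y f h)
      rw [this]
      exact zero_mem _
  · rw [← hT]
    exact Submodule.subset_span (Finset.mem_sigma.1 ht).2

end RadPow

/-! ### Functors from path categories and kernels -/

namespace PathCat

variable {k : Type w} [Field k] {V : Type u} [Quiver.{v} V]

theorem ofPath_comp {x y z : PathCat k V} (p : Quiver.Path x.pt y.pt)
    (q : Quiver.Path y.pt z.pt) :
    ofPath (k := k) p ≫ ofPath q = ofPath (x := x) (y := z) (p.comp q) := by
  refine (compHom_single p q (1 : k) 1).trans ?_
  rw [one_mul]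
  rfl

theorem hom_induction {x y : PathCat k V} {P : (x ⟶ y) → Prop} (zero : P 0)
    (add : ∀ f g, P f → P g → P (f + g))
    (smul_ofPath : ∀ (a : k) (q : Quiver.Path x.pt y.pt), P (a • ofPath q)) (f : x ⟶ y) : P f := by
  refine Finsupp.induction_linear f zero add fun q a => ?_
  have e : (a • ofPath q : x ⟶ y) = (Finsupp.single q a : Quiver.Path x.pt y.pt →₀ k) := by
    refine (Finsupp.smul_single a q (1 : k)).trans ?_
    rw [smul_eq_mul, mul_one]
  exact e ▸ smul_ofPath a q

variable {C : Type u₁} [Category.{v₁} C] [Preadditive C] [Linear k C]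

variable (k) in
/-- The action on morphisms of `PathCat.lift`. -/
def liftHom (φ : V ⥤q C) (x y : PathCat k V) : (x ⟶ y) →ₗ[k] (φ.obj x.pt ⟶ φ.obj y.pt) :=
  Finsupp.linearCombination k fun q : Quiver.Path x.pt y.pt => composePath (φ.mapPath q)

theorem liftHom_ofPath (φ : V ⥤q C) {x y : PathCat k V} (q : Quiver.Path x.pt y.pt) :
    liftHom k φ x y (ofPath q) = composePath (φ.mapPath q) :=
  (Finsupp.linearCombination_single k 1 q).trans (one_smul _ _)

theorem liftHom_comp (φ : V ⥤q C) {x y z : PathCat k V} (f : x ⟶ y) (g : y ⟶ z) :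
    liftHom k φ x z (f ≫ g) = liftHom k φ x y f ≫ liftHom k φ y z g := by
  induction f using hom_induction with
  | zero => simp
  | add f f' h h' => simp only [Preadditive.add_comp, map_add, h, h']
  | smul_ofPath a p =>
    induction g using hom_induction with
    | zero => simp
    | add g g' h h' => simp only [Preadditive.comp_add, map_add, h, h']
    | smul_ofPath b q =>
      simp only [Linear.smul_comp, Linear.comp_smul, map_smul, ofPath_comp, liftHom_ofPath,
        Prefunctor.mapPath_comp, composePath_comp]

variable (k) in
/-- The linear functor `kQ ⥤ C` which extends a morphism of quivers. -/
def lift (φ : V ⥤q C) : PathCat k V ⥤ C where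
  obj x := φ.obj x.pt
  map {x y} f := liftHom k φ x y f
  map_id x := liftHom_ofPath φ (x := x) (y := x) Quiver.Path.nil
  map_comp f g := liftHom_comp φ f g

instance (φ : V ⥤q C) : (lift k φ).Additive where
  map_add {_ _} f g := map_add (liftHom k φ _ _) f g

instance (φ : V ⥤q C) : (lift k φ).Linear k where
  map_smul {_ _} f a := map_smul (liftHom k φ _ _) a f

theorem lift_map_ofPath (φ : V ⥤q C) {x y : PathCat k V} (q : Quiver.Path x.pt y.pt) :
    (lift k φ).map (ofPath q) = composePath (φ.mapPath q) :=
  liftHom_ofPath φ q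

theorem map_map_ofPath {W : Type u₂} [Quiver.{v₂} W] (p : V ⥤q W) {x y : PathCat k V}
    (q : Quiver.Path x.pt y.pt) :
    (map k p).map (ofPath q) =
      ofPath (x := (map k p).obj x) (y := (map k p).obj y) (p.mapPath q) :=
  Finsupp.mapDomain_single

end PathCat

section Kernel

variable {k : Type w} [Field k] {C : Type u} [Category.{v} C] [Preadditive C] [Linear k C]
  {D : Type u₁} [Category.{v₁} D] [Preadditive D] [Linear k D]
  (H : C ⥤ D) [H.Additive] [H.Linear k]

variable (k) in
/-- The kernel of a linear functor. -/
def CatIdeal.ker : CatIdeal k C where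
  hom x y := LinearMap.ker (H.mapLinearMap k (X := x) (Y := y))
  comp_mem f g hg := by
    rw [LinearMap.mem_ker, Functor.coe_mapLinearMap] at hg ⊢
    rw [H.map_comp, hg, Limits.comp_zero]
  mem_comp f g hf := by
    rw [LinearMap.mem_ker, Functor.coe_mapLinearMap] at hf ⊢
    rw [H.map_comp, hf, Limits.zero_comp]

theorem CatIdeal.mem_ker {x y : C} (f : x ⟶ y) : f ∈ (CatIdeal.ker k H).hom x y ↔ H.map f = 0 :=
  Iff.rfl

variable (k) in
/-- The functor `C/ker H ⥤ D` induced by `H`. -/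
def IdealQuot.kerLift : IdealQuot (CatIdeal.ker k H) ⥤ D where
  obj x := H.obj x.as
  map {x y} := Submodule.liftQ ((CatIdeal.ker k H).hom x.as y.as) (H.mapLinearMap k) le_rfl
  map_id x := H.map_id x.as
  map_comp f g := by
    obtain ⟨f, rfl⟩ := Submodule.Quotient.mk_surjective _ f
    obtain ⟨g, rfl⟩ := Submodule.Quotient.mk_surjective _ g
    exact H.map_comp f g

theorem IdealQuot.kerLift_additive : (IdealQuot.kerLift k H).Additive where
  map_add {x y} f g :=
    map_add (Submodule.liftQ ((CatIdeal.ker k H).hom x.as y.as) (H.mapLinearMap k) le_rfl) f g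

theorem IdealQuot.kerLift_linear : (IdealQuot.kerLift k H).Linear k where
  map_smul {x y} f a :=
    map_smul (Submodule.liftQ ((CatIdeal.ker k H).hom x.as y.as) (H.mapLinearMap k) le_rfl) a f

theorem IdealQuot.isIso_kerLift (hobj : Function.Bijective H.obj)
    (hmap : ∀ x y : C, Function.Surjective (fun f : x ⟶ y => H.map f)) :
    IsIsoOfCategories (IdealQuot.kerLift k H) where
  bijective_obj := by
    refine ⟨fun x y h => ?_, fun x => ?_⟩
    · cases x
      cases y
      exact congrArg _ (hobj.1 h)
    · obtain ⟨y, rfl⟩ := hobj.2 x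
      exact ⟨⟨y⟩, rfl⟩
  bijective_map x y := by
    refine ⟨?_, fun f => ?_⟩
    · have := LinearMap.ker_eq_bot.1 (Submodule.ker_liftQ_eq_bot
        ((CatIdeal.ker k H).hom x.as y.as) (H.mapLinearMap k) le_rfl le_rfl)
      exact this
    · obtain ⟨g, rfl⟩ := hmap _ _ f
      exact ⟨(Submodule.Quotient.mk g : (x.as ⟶ y.as) ⧸ (CatIdeal.ker k H).hom x.as y.as), rfl⟩

end Kernel

/-! ### Bases of the radical modulo its square -/

section ArrowBasis

variable (k : Type w) [Field k] {C : Type u} [Category.{v} C] [Preadditive C] [Linear k C]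

/-- The morphisms `arr x y a`, for `a` in `A x y`, form a basis of the radical modulo its
square. -/
structure IsArrowBasis (A : C → C → Type v₁) (arr : ∀ x y : C, A x y → (x ⟶ y)) : Prop where
  mem : ∀ (x y : C) (a : A x y), arr x y a ∈ radical k x y
  linearIndependent : ∀ x y : C, LinearIndependent k fun a => (radicalSq k x y).mkQ (arr x y a)
  le_span : ∀ x y : C, radical k x y ≤ Submodule.span k (Set.range (arr x y)) ⊔ radicalSq k x y

/-- The morphism of quivers which sends each arrow to the chosen morphism. -/
abbrev arrowPrefunctor {A : C → C → Type v₁} (arr : ∀ x y : C, A x y → (x ⟶ y)) : Vert A ⥤q C where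
  obj x := x.pt
  map {x y} a := arr x.pt y.pt a

namespace IsArrowBasis

variable {k} {A : C → C → Type v₁} {arr : ∀ x y : C, A x y → (x ⟶ y)}

variable (k) in
/-- The evaluation of linear combinations of paths, for a choice of morphisms for the arrows. -/
def evalHom (arr : ∀ x y : C, A x y → (x ⟶ y)) (x y : C) :
    ((⟨⟨x⟩⟩ : PathCat k (Vert A)) ⟶ ⟨⟨y⟩⟩) →ₗ[k] (x ⟶ y) :=
  PathCat.liftHom k (arrowPrefunctor arr) ⟨⟨x⟩⟩ ⟨⟨y⟩⟩

theorem composePath_mem_radPow (hA : IsArrowBasis k A arr) {x y : Vert A}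
    (q : Quiver.Path x y) :
    (composePath ((arrowPrefunctor arr).mapPath q) : x.pt ⟶ y.pt) ∈
      radPow k q.length x.pt y.pt := by
  induction q with
  | nil => exact Submodule.mem_top
  | cons q a ih => exact comp_mem_radPow_succ ih (hA.mem _ _ a)

theorem arr_ne_zero (hA : IsArrowBasis k A arr) {x y : C} (a : A x y) : arr x y a ≠ 0 := by
  intro h
  apply (hA.linearIndependent x y).ne_zero a
  rw [h, map_zero]

theorem finite (hA : IsArrowBasis k A arr) (hC : IsLocallyBounded k C) (x y : C) :
    Finite (A x y) := by
  have := hC.finite_hom x y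
  exact (hA.linearIndependent x y).finite

/-- Independence in `IsArrowBasis` is stated in the quotient of the whole morphism space, while the
ordinary quiver counts a dimension of the radical modulo its square; the natural map `ι` between
these quotients carries the basis over. -/
theorem isOrdinaryQuiver (hA : IsArrowBasis k A arr) (hC : IsLocallyBounded k C) :
    IsOrdinaryQuiver k A := by
  intro x y
  have hfin := hA.finite hC x y
  refine ⟨hfin, ?_⟩
  let N := (radicalSq k x y).submoduleOf (radical k x y)
  let b : A x y → radical k x y ⧸ N := fun a => N.mkQ ⟨arr x y a, hA.mem x y a⟩
  let ι : (radical k x y ⧸ N) →ₗ[k] (x ⟶ y) ⧸ radicalSq k x y :=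
    N.mapQ (radicalSq k x y) (radical k x y).subtype le_rfl
  have hb : LinearIndependent k b := LinearIndependent.of_comp ι (hA.linearIndependent x y)
  have hspan : ⊤ ≤ Submodule.span k (Set.range b) := by
    rintro f -
    obtain ⟨⟨f, hf⟩, rfl⟩ := N.mkQ_surjective f
    obtain ⟨g, hg, r, hr, e⟩ := Submodule.mem_sup.1 (hA.le_span x y hf)
    have hspan' : Submodule.span k (Set.range (arr x y)) ≤
        ((Submodule.span k (Set.range b)).comap N.mkQ).map (radical k x y).subtype := by
      refine Submodule.span_le.2 ?_
      rintro _ ⟨a, rfl⟩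
      exact ⟨⟨arr x y a, hA.mem x y a⟩, Submodule.subset_span ⟨a, rfl⟩, rfl⟩
    obtain ⟨⟨g, hg'⟩, hgb, rfl⟩ := hspan' hg
    have hmk : N.mkQ ⟨f, hf⟩ = N.mkQ ⟨g, hg'⟩ := by
      refine (Submodule.Quotient.eq _).2 ?_
      change f - g ∈ radicalSq k x y
      rw [← e]
      simpa using hr
    rw [hmk]
    exact hgb
  have := (Module.finrank_eq_nat_card_basis (Module.Basis.mk hb hspan)).symm
  exact this

/-- Arrows evaluate to nonzero morphisms, so their other ends lie in a finite set. -/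
theorem isLocallyFiniteQuiver (hA : IsArrowBasis k A arr) (hC : IsLocallyBounded k C) :
    IsLocallyFiniteQuiver (Vert A) := by
  have hfin : ∀ x y : Vert A, Finite (x ⟶ y) := fun x y => hA.finite hC x.pt y.pt
  intro x
  constructor
  · obtain ⟨S, hS⟩ := hC.exists_finset_source x.pt
    have := fun y => hA.finite hC x.pt y
    refine Finite.of_injective (β := Σ y : S, A x.pt y.1)
      (fun a => ⟨⟨a.1.pt, hS _ _ (hA.arr_ne_zero a.2)⟩, a.2⟩) ?_
    rintro ⟨⟨y⟩, a⟩ ⟨⟨z⟩, b⟩ h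
    simp only [Sigma.mk.injEq, Subtype.mk.injEq] at h
    obtain ⟨rfl, h⟩ := h
    rw [eq_of_heq h]
  · obtain ⟨S, hS⟩ := hC.exists_finset_target x.pt
    have := fun y => hA.finite hC y x.pt
    refine Finite.of_injective (β := Σ y : S, A y.1 x.pt)
      (fun a => ⟨⟨a.1.pt, hS _ _ (hA.arr_ne_zero a.2)⟩, a.2⟩) ?_
    rintro ⟨⟨y⟩, a⟩ ⟨⟨z⟩, b⟩ h
    simp only [Sigma.mk.injEq, Subtype.mk.injEq] at h
    obtain ⟨rfl, h⟩ := h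
    rw [eq_of_heq h]

/-- The span of the composites of the paths of length `n`. -/
def pathSpan (k : Type w) [Field k] {C : Type u} [Category.{v} C] [Preadditive C] [Linear k C]
    {A : C → C → Type v₁} (arr : ∀ x y : C, A x y → (x ⟶ y)) (n : ℕ) (x y : C) :
    Submodule k (x ⟶ y) :=
  Submodule.span k {f | ∃ q : Quiver.Path (⟨x⟩ : Vert A) ⟨y⟩, q.length = n ∧
    f = composePath ((arrowPrefunctor arr).mapPath q)}

theorem pathSpan_le_radPow (hA : IsArrowBasis k A arr) (n : ℕ) (x y : C) :
    pathSpan k arr n x y ≤ radPow k n x y := by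
  refine Submodule.span_le.2 ?_
  rintro _ ⟨q, rfl, rfl⟩
  exact hA.composePath_mem_radPow q

theorem comp_mem_pathSpan {n : ℕ} {x y z : C} {f : x ⟶ y}
    (hf : f ∈ pathSpan k arr n x y) {g : y ⟶ z} (hg : g ∈ Submodule.span k (Set.range (arr y z))) :
    f ≫ g ∈ pathSpan k arr (n + 1) x z := by
  induction hg using Submodule.span_induction with
  | mem g hg =>
    obtain ⟨a, rfl⟩ := hg
    induction hf using Submodule.span_induction with
    | mem f hf =>
      obtain ⟨q, rfl, rfl⟩ := hf
      exact Submodule.subset_span ⟨q.cons a, rfl, rfl⟩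
    | zero => simp
    | add f f' _ _ h h' => rw [Preadditive.add_comp]; exact add_mem h h'
    | smul c f _ h => rw [Linear.smul_comp]; exact Submodule.smul_mem _ _ h
  | zero => simp
  | add f f' _ _ h h' => rw [Preadditive.comp_add]; exact add_mem h h'
  | smul c f _ h => rw [Linear.comp_smul]; exact Submodule.smul_mem _ _ h

theorem comp_radicalSq_mem_radPow {n : ℕ} {x y z : C} {f : x ⟶ y} (hf : f ∈ radPow k n x y)
    {g : y ⟶ z} (hg : g ∈ radicalSq k y z) : f ≫ g ∈ radPow k (n + 2) x z := by
  induction hg using Submodule.span_induction with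
  | mem g hg =>
    obtain ⟨t, g, h, hg, hh, rfl⟩ := hg
    rw [← Category.assoc]
    exact comp_mem_radPow_succ (comp_mem_radPow_succ hf hg) hh
  | zero => simp
  | add f f' _ _ h h' => rw [Preadditive.comp_add]; exact add_mem h h'
  | smul c f _ h => rw [Linear.comp_smul]; exact Submodule.smul_mem _ _ h

/-- For `n = 0`, an endomorphism is a scalar modulo the radical, and a morphism between distinct
objects is radical. In the inductive step, split both factors: the product of the path part with the
arrow part is again a combination of paths, and all other products fall one power deeper. -/
theorem radPow_le_pathSpan_sup [IsAlgClosed k] (hA : IsArrowBasis k A arr)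
    (hC : IsLocallyBounded k C) (n : ℕ) (x y : C) :
    radPow k n x y ≤ pathSpan k arr n x y ⊔ radPow k (n + 1) x y := by
  induction n generalizing y with
  | zero =>
    intro f _
    rw [zero_add, radPow_one_eq hC]
    by_cases h : x = y
    · subst h
      obtain ⟨c, hc⟩ := hC.exists_sub_smul_id_mem_radical f
      rw [← add_sub_cancel (c • 𝟙 x) f]
      exact Submodule.add_mem_sup (Submodule.smul_mem _ _
        (Submodule.subset_span ⟨Quiver.Path.nil, rfl, rfl⟩)) hc
    · exact Submodule.mem_sup_right (hC.mem_radical_of_ne h f)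
  | succ n ih =>
    refine Submodule.span_le.2 ?_
    rintro _ ⟨z, f, g, hf, hg, rfl⟩
    obtain ⟨p, hp, f', hf', rfl⟩ := Submodule.mem_sup.1 (ih z hf)
    obtain ⟨a, ha, s, hs, rfl⟩ := Submodule.mem_sup.1 (hA.le_span z y hg)
    have e : (p + f') ≫ (a + s) = p ≫ a + (p ≫ s + f' ≫ (a + s)) := by
      rw [Preadditive.add_comp, Preadditive.comp_add _ _ _ p, add_assoc]
    rw [e]
    exact Submodule.add_mem_sup (comp_mem_pathSpan hp ha) (add_mem
      (comp_radicalSq_mem_radPow (hA.pathSpan_le_radPow _ _ _ hp) hs)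
      (comp_mem_radPow_succ hf' hg))

theorem pathSpan_le_range (n : ℕ) (x y : C) : pathSpan k arr n x y ≤
    LinearMap.range (evalHom k arr x y) := by
  refine Submodule.span_le.2 ?_
  rintro _ ⟨q, -, rfl⟩
  exact ⟨PathCat.ofPath (x := (⟨⟨x⟩⟩ : PathCat k (Vert A))) (y := ⟨⟨y⟩⟩) q,
    PathCat.liftHom_ofPath (arrowPrefunctor arr) q⟩

/-- Successive approximation: a morphism is a combination of paths modulo every power of the
radical, and some power vanishes. -/
theorem range_evalHom [IsAlgClosed k] (hA : IsArrowBasis k A arr) (hC : IsLocallyBounded k C)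
    (x y : C) : LinearMap.range (evalHom k arr x y) = ⊤ := by
  have key : ∀ n, LinearMap.range (evalHom k arr x y) ⊔
      radPow k n x y = ⊤ := by
    intro n
    induction n with
    | zero => exact sup_top_eq _
    | succ n ih =>
      rw [eq_top_iff, ← ih]
      refine sup_le le_sup_left ((hA.radPow_le_pathSpan_sup hC n x y).trans ?_)
      exact sup_le_sup_right (pathSpan_le_range n x y) _
  obtain ⟨n, hn⟩ := exists_radPow_eq_bot hC x
  have := key n
  rwa [hn y, sup_bot_eq] at this

theorem lift_map_surjective [IsAlgClosed k] (hA : IsArrowBasis k A arr)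
    (hC : IsLocallyBounded k C) (x y : PathCat k (Vert A)) :
    Function.Surjective fun f : x ⟶ y => (PathCat.lift k (arrowPrefunctor arr)).map f :=
  (LinearMap.range_eq_top (f := evalHom k arr x.pt.pt y.pt.pt)).1
    (hA.range_evalHom hC x.pt.pt y.pt.pt)

/-! ### Admissibility of the kernel of evaluation -/

theorem exists_length_lift_eq_zero (hA : IsArrowBasis k A arr) (hC : IsLocallyBounded k C)
    (x : C) : ∃ n : ℕ, ∀ (y : Vert A) (q : Quiver.Path (⟨x⟩ : Vert A) y), n ≤ q.length →
      composePath ((arrowPrefunctor arr).mapPath q) = 0 := by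
  obtain ⟨n, hn⟩ := exists_radPow_eq_bot hC x
  refine ⟨n, fun y q hq => ?_⟩
  have := radPow_antitone (k := k) _ _ hq (hA.composePath_mem_radPow q)
  dsimp only at this
  rwa [hn, Submodule.mem_bot] at this

theorem composePath_mem_radical (hA : IsArrowBasis k A arr) (hC : IsLocallyBounded k C)
    {x y : Vert A} (q : Quiver.Path x y) (hq : 1 ≤ q.length) :
    (composePath ((arrowPrefunctor arr).mapPath q) : x.pt ⟶ y.pt) ∈ radical k x.pt y.pt := by
  rw [← radPow_one_eq hC]
  exact radPow_antitone x.pt y.pt hq (hA.composePath_mem_radPow q)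

theorem composePath_mem_radicalSq (hA : IsArrowBasis k A arr) (hC : IsLocallyBounded k C)
    {x y : Vert A} (q : Quiver.Path x y) (hq : 2 ≤ q.length) :
    (composePath ((arrowPrefunctor arr).mapPath q) : x.pt ⟶ y.pt) ∈ radicalSq k x.pt y.pt := by
  rw [← radPow_two_eq hC]
  exact radPow_antitone x.pt y.pt hq (hA.composePath_mem_radPow q)

theorem evalHom_mem {x y : C} (N : Submodule k (x ⟶ y))
    (r : Quiver.Path (⟨x⟩ : Vert A) ⟨y⟩ →₀ k)
    (h : ∀ q ∈ r.support, composePath ((arrowPrefunctor arr).mapPath q) ∈ N) :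
    evalHom k arr x y r ∈ N := by
  have : evalHom k arr x y r = r.sum fun q c => c • composePath ((arrowPrefunctor arr).mapPath q) :=
    Finsupp.linearCombination_apply k r
  rw [this]
  exact Submodule.sum_mem N fun q hq => Submodule.smul_mem N _ (h q hq)

/-- Non-trivial paths evaluate into the radical and the identity does not, so the trivial path
cannot contribute. -/
theorem coeff_eq_zero_of_length_eq_zero (hA : IsArrowBasis k A arr) (hC : IsLocallyBounded k C)
    {x y : C} {r : Quiver.Path (⟨x⟩ : Vert A) ⟨y⟩ →₀ k}
    (hr : evalHom k arr x y r ∈ radical k x y) (q : Quiver.Path (⟨x⟩ : Vert A) ⟨y⟩)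
    (hq : q.length = 0) : r q = 0 := by
  classical
  obtain rfl : x = y := congrArg Vert.pt (Quiver.Path.eq_of_length_zero q hq)
  obtain rfl := Quiver.Path.eq_nil_of_length_zero q hq
  by_contra h
  have hrest : evalHom k arr x x (r.erase Quiver.Path.nil) ∈ radical k x x := by
    refine evalHom_mem _ _ fun q hq => hA.composePath_mem_radical hC q ?_
    rw [Finsupp.support_erase, Finset.mem_erase] at hq
    by_contra! hlt
    exact hq.1 (Quiver.Path.eq_nil_of_length_zero q (by omega))
  have hsplit : evalHom k arr x x r =
      r Quiver.Path.nil • 𝟙 x + evalHom k arr x x (r.erase Quiver.Path.nil) := by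
    have e : evalHom k arr x x (Finsupp.single Quiver.Path.nil (r Quiver.Path.nil)) =
        r Quiver.Path.nil • 𝟙 x := Finsupp.linearCombination_single k _ _
    rw [← e]
    refine Eq.trans ?_ (map_add (evalHom k arr x x)
      (Finsupp.single Quiver.Path.nil (r Quiver.Path.nil)) (r.erase Quiver.Path.nil))
    exact congrArg (evalHom k arr x x) (Finsupp.single_add_erase Quiver.Path.nil r).symm
  rw [hsplit] at hr
  have := (Submodule.add_mem_iff_left _ hrest).1 hr
  exact hC.id_notMem_radical x ((Submodule.smul_mem_iff _ h).1 this)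

/-- Modulo the square of the radical only the arrows survive, and their classes are independent.
Together with `coeff_eq_zero_of_length_eq_zero`, this puts the kernel inside `(kQ⁺)²`. -/
theorem coeff_eq_zero_of_length_eq_one (hA : IsArrowBasis k A arr) (hC : IsLocallyBounded k C)
    {x y : C} {r : Quiver.Path (⟨x⟩ : Vert A) ⟨y⟩ →₀ k}
    (hr : evalHom k arr x y r ∈ radicalSq k x y)
    (h0 : ∀ q : Quiver.Path (⟨x⟩ : Vert A) ⟨y⟩, q.length = 0 → r q = 0)
    (q : Quiver.Path (⟨x⟩ : Vert A) ⟨y⟩) (hq : q.length = 1) : r q = 0 := by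
  classical
  let P : Quiver.Path (⟨x⟩ : Vert A) ⟨y⟩ → Prop := fun q => q.length = 1
  let toPath : A x y → Quiver.Path (⟨x⟩ : Vert A) ⟨y⟩ := fun a => Quiver.Path.nil.cons a
  have hinj : Function.Injective toPath := fun a b h =>
    eq_of_heq (Quiver.Path.hom_heq_of_cons_eq_cons h)
  have hrest : evalHom k arr x y (r.filter fun q => ¬ P q) ∈ radicalSq k x y := by
    refine evalHom_mem _ _ fun q hq => hA.composePath_mem_radicalSq hC q ?_
    rw [Finsupp.support_filter, Finset.mem_filter, Finsupp.mem_support_iff] at hq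
    have h0' : q.length ≠ 0 := fun h => hq.1 (h0 q h)
    have h1 : q.length ≠ 1 := hq.2
    omega
  -- The coefficients of `r` on paths of length one, indexed by the arrows themselves.
  let g : A x y →₀ k := (r.filter P).comapDomain toPath hinj.injOn
  have hg : g.mapDomain toPath = r.filter P := by
    refine Finsupp.mapDomain_comapDomain toPath hinj _ fun q hq => ?_
    rw [Finset.mem_coe, Finsupp.support_filter, Finset.mem_filter] at hq
    obtain ⟨-, hq⟩ := hq
    change q.length = 1 at hq
    obtain ⟨z, q', a, rfl⟩ := (Quiver.Path.length_ne_zero_iff_eq_cons q).1 (by omega)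
    have hq' : q'.length = 0 := by simpa using hq
    obtain rfl := Quiver.Path.eq_of_length_zero q' hq'
    obtain rfl := Quiver.Path.eq_nil_of_length_zero q' hq'
    exact ⟨a, rfl⟩
  have hP : evalHom k arr x y (r.filter P) = Finsupp.linearCombination k (arr x y) g := by
    rw [← hg]
    refine (Finsupp.linearCombination_mapDomain k toPath g).trans ?_
    congr 2
    funext a
    exact Category.id_comp _
  have hmem : Finsupp.linearCombination k (arr x y) g ∈ radicalSq k x y := by
    rw [← hP]
    refine (Submodule.add_mem_iff_left _ hrest).1 ?_
    have e : evalHom k arr x y r =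
        evalHom k arr x y (r.filter P) + evalHom k arr x y (r.filter fun q => ¬ P q) := by
      refine Eq.trans ?_ (map_add (evalHom k arr x y) (r.filter P) (r.filter fun q => ¬ P q))
      exact congrArg (evalHom k arr x y) (Finsupp.filter_add_filter_not r P).symm
    exact e ▸ hr
  have hg0 : g = 0 := by
    refine linearIndependent_iff.1 (hA.linearIndependent x y) g ?_
    have := Finsupp.apply_linearCombination k (radicalSq k x y).mkQ (arr x y) g
    refine this.symm.trans ?_
    rwa [Submodule.mkQ_apply, Submodule.Quotient.mk_eq_zero]
  have : r.filter P q = 0 := by rw [← hg, hg0, Finsupp.mapDomain_zero, Finsupp.zero_apply]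
  rwa [Finsupp.filter_apply_pos P r hq] at this

theorem isAdmissible_ker (hA : IsArrowBasis k A arr) (hC : IsLocallyBounded k C) :
    IsAdmissible (CatIdeal.ker k (PathCat.lift k (arrowPrefunctor arr))) where
  le_sq x y r hr := by
    have hr : 0 = evalHom k arr x.pt.pt y.pt.pt (PathCat.coeffs r) := hr.symm
    have h0 := coeff_eq_zero_of_length_eq_zero hA hC (r := PathCat.coeffs r)
      (hr ▸ zero_mem _)
    have h1 := coeff_eq_zero_of_length_eq_one hA hC (r := PathCat.coeffs r)
      (hr ▸ zero_mem _) h0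
    intro q hq
    rw [Finsupp.mem_support_iff] at hq
    by_contra! hlt
    interval_cases h : q.length
    · exact hq (h0 q h)
    · exact hq (h1 q h)
  long_paths := by
    choose n hn using hA.exists_length_lift_eq_zero hC
    intro x
    obtain ⟨S, hS⟩ := hC.exists_finset_target x.pt.pt
    -- The bound `n` depends on the source of a path. A path into `x` with nonzero value starts in
    -- the finite set `S`, so the supremum over `S` serves for paths ending at `x`; the `2` is
    -- demanded by the definition.
    refine ⟨max 2 (max (n x.pt.pt) (S.sup n)), le_max_left _ _,
      fun y => ⟨fun q hq => ?_, fun q hq => ?_⟩⟩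
    · rw [CatIdeal.mem_ker, PathCat.lift_map_ofPath]
      exact hn x.pt.pt y.pt q ((le_max_left _ _).trans ((le_max_right _ _).trans hq))
    · rw [CatIdeal.mem_ker, PathCat.lift_map_ofPath]
      by_contra h
      have hy := hS y.pt.pt _ h
      exact h (hn y.pt.pt x.pt q ((Finset.le_sup hy).trans
        ((le_max_right _ _).trans ((le_max_right _ _).trans hq))))

theorem isAdmissiblePresentation [IsAlgClosed k] (hA : IsArrowBasis k A arr)
    (hC : IsLocallyBounded k C) :
    IsAdmissiblePresentation
      (IdealQuot.kerLift k (PathCat.lift k (arrowPrefunctor arr))) where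
  locallyFinite := hA.isLocallyFiniteQuiver hC
  ordinary := hA.isOrdinaryQuiver hC
  admissible := hA.isAdmissible_ker hC
  additive := IdealQuot.kerLift_additive _
  linear := IdealQuot.kerLift_linear _
  isIso := by
    refine IdealQuot.isIso_kerLift _ ⟨?_, fun x => ⟨⟨⟨x⟩⟩, rfl⟩⟩ (hA.lift_map_surjective hC)
    rintro ⟨⟨x⟩⟩ ⟨⟨y⟩⟩ rfl
    rfl

end IsArrowBasis

end ArrowBasis

/-! ### The morphism spaces of a quotient category -/

namespace FreeGCategory

variable {k : Type w} [Field k] {G : Type u₃} [Group G] {E : Type u₁}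
  [Category.{v₁} E] [Preadditive E] [Linear k E] (ρ : FreeGCategory k G E)

/-- The translation by `g`, with propositionally equal source and target. -/
def translate (g : G) {x₁ y₁ x y : E} (hx : (ρ.act g).obj x₁ = x) (hy : (ρ.act g).obj y₁ = y) :
    (x₁ ⟶ y₁) →ₗ[k] (x ⟶ y) :=
  Linear.leftComp k y (eqToHom hx.symm) ∘ₗ Linear.rightComp k _ (eqToHom hy) ∘ₗ
    (ρ.act g).mapLinearMap k

theorem translate_apply (g : G) {x₁ y₁ x y : E} (hx : (ρ.act g).obj x₁ = x)
    (hy : (ρ.act g).obj y₁ = y) (u : x₁ ⟶ y₁) :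
    ρ.translate g hx hy u = eqToHom hx.symm ≫ (ρ.act g).map u ≫ eqToHom hy := rfl

theorem translate_translate (g h : G) {x₁ y₁ x y x' y' : E} (hx : (ρ.act g).obj x₁ = x)
    (hy : (ρ.act g).obj y₁ = y) (hx' : (ρ.act h).obj x = x') (hy' : (ρ.act h).obj y = y')
    (hx'' : (ρ.act (h * g)).obj x₁ = x') (hy'' : (ρ.act (h * g)).obj y₁ = y') (u : x₁ ⟶ y₁) :
    ρ.translate h hx' hy' (ρ.translate g hx hy u) = ρ.translate (h * g) hx'' hy'' u := by
  subst hx hy hx' hy'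
  simp [translate_apply, map_mul]

theorem translate_one {x y : E} (hx : (ρ.act 1).obj x = x) (hy : (ρ.act 1).obj y = y)
    (u : x ⟶ y) : ρ.translate 1 hx hy u = u := by
  rw [translate_apply, Functor.congr_hom ρ.act_one u]
  simp

theorem translate_congr {g h : G} {x₁ y₁ x y : E} (hx : (ρ.act g).obj x₁ = x)
    (hy : (ρ.act g).obj y₁ = y) (hx' : (ρ.act h).obj x₁ = x) (hy' : (ρ.act h).obj y₁ = y) :
    ρ.translate g hx hy = ρ.translate h hx' hy' := by
  obtain rfl := ρ.eq_of_obj_eq (hx.trans hx'.symm)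
  rfl

open Classical in
/-- The translation from `E(x₁, y₁)` to `E(x, y)`, or zero when no element of `G` moves
`(x₁, y₁)` to `(x, y)`. -/
def transport (x₁ y₁ x y : E) : (x₁ ⟶ y₁) →ₗ[k] (x ⟶ y) :=
  if h : ∃ g : G, (ρ.act g).obj x₁ = x ∧ (ρ.act g).obj y₁ = y then
    ρ.translate h.choose h.choose_spec.1 h.choose_spec.2 else 0

/-- By freeness the moving element is unique, so the choice made in `transport` is immaterial. -/
theorem transport_eq (g : G) {x₁ y₁ x y : E} (hx : (ρ.act g).obj x₁ = x)
    (hy : (ρ.act g).obj y₁ = y) : ρ.transport x₁ y₁ x y = ρ.translate g hx hy := by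
  have h : ∃ g : G, (ρ.act g).obj x₁ = x ∧ (ρ.act g).obj y₁ = y := ⟨g, hx, hy⟩
  rw [transport, dif_pos h]
  exact ρ.translate_congr _ _ _ _

theorem transport_eq_zero {x₁ y₁ x y : E}
    (h : ¬ ∃ g : G, (ρ.act g).obj x₁ = x ∧ (ρ.act g).obj y₁ = y) :
    ρ.transport x₁ y₁ x y = 0 := dif_neg h

/-- This invariance lets the transports descend from the direct sum to the morphism spaces of `E/G`.
-/
theorem transport_act (g : G) {x₁ y₁ : E} (x y : E) (u : x₁ ⟶ y₁) :
    ρ.transport _ _ x y ((ρ.act g).map u) = ρ.transport x₁ y₁ x y u := by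
  by_cases h : ∃ h : G, (ρ.act h).obj ((ρ.act g).obj x₁) = x ∧
      (ρ.act h).obj ((ρ.act g).obj y₁) = y
  · obtain ⟨h, hx, hy⟩ := h
    have hx' := (ρ.mul_obj h g x₁).trans hx
    have hy' := (ρ.mul_obj h g y₁).trans hy
    rw [ρ.transport_eq h hx hy, ρ.transport_eq (h * g) hx' hy',
      ← ρ.translate_translate g h rfl rfl hx hy hx' hy']
    simp [translate_apply]
  · rw [ρ.transport_eq_zero h, ρ.transport_eq_zero, LinearMap.zero_apply, LinearMap.zero_apply]
    rintro ⟨h', hx, hy⟩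
    refine h ⟨h' * g⁻¹, ?_, ?_⟩
    · rw [ρ.mul_obj, ρ.inv_obj, hx]
    · rw [ρ.mul_obj, ρ.inv_obj, hy]

theorem transport_self {x y : E} (u : x ⟶ y) : ρ.transport x y x y u = u := by
  rw [ρ.transport_eq 1 (ρ.one_obj x) (ρ.one_obj y), translate_one]

/-- An element fixing `x` is `1` by freeness and so cannot move `y₁`. This is what makes the sum
over a fibre direct. -/
theorem transport_of_ne {x y₁ y : E} (h : y₁ ≠ y) : ρ.transport x y₁ x y = 0 := by
  refine ρ.transport_eq_zero ?_
  rintro ⟨g, hx, hy⟩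
  obtain rfl := ρ.free g x hx
  exact h ((ρ.one_obj y₁).symm.trans hy)

open Classical in
/-- The component in `E(x, y)` of a morphism between the orbits of `x` and `y`. -/
def component (x y : E) : ρ.QuotHom (ρ.toOrbit x) (ρ.toOrbit y) →ₗ[k] (x ⟶ y) :=
  Submodule.liftQ _ (DirectSum.toModule k _ _ fun q => ρ.transport q.1.1 q.1.2 x y) (by
    refine Submodule.span_le.2 ?_
    rintro _ ⟨g, x₁, y₁, hx, hy, u, rfl⟩
    rw [SetLike.mem_coe, LinearMap.mem_ker, map_sub]
    unfold incl
    rw [DirectSum.toModule_lof, DirectSum.toModule_lof, transport_act, sub_self])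

open Classical in
theorem component_cls {x y x₁ y₁ : E} (hx : ρ.toOrbit x₁ = ρ.toOrbit x)
    (hy : ρ.toOrbit y₁ = ρ.toOrbit y) (u : x₁ ⟶ y₁) :
    ρ.component x y (ρ.cls hx hy u) = ρ.transport x₁ y₁ x y u :=
  DirectSum.toModule_lof k (M := fun q : ρ.Pairs (ρ.toOrbit x) (ρ.toOrbit y) => (q.1.1 ⟶ q.1.2))
    (φ := fun q => ρ.transport q.1.1 q.1.2 x y) ⟨(x₁, y₁), hx, hy⟩ u

/-- Any class can be translated by `G` so that its source becomes `x`. -/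
theorem span_cls (x : E) (β : ρ.OrbitCat) :
    Submodule.span k {b : ρ.QuotHom (ρ.toOrbit x) β | ∃ (y : E) (hy : ρ.toOrbit y = β) (u : x ⟶ y),
      b = ρ.cls rfl hy u} = ⊤ := by
  -- The span is everything once the projection modulo it vanishes, and `linearMap_ext` tests this
  -- on classes.
  rw [← Submodule.ker_mkQ (Submodule.span k _), LinearMap.ker_eq_top]
  apply ρ.linearMap_ext
  intro x₁ y₁ hx hy u
  obtain ⟨y, hy', u', e⟩ := ρ.exists_cls_eq rfl hx hy u
  rw [e, LinearMap.zero_apply, Submodule.mkQ_apply, Submodule.Quotient.mk_eq_zero]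
  exact Submodule.subset_span ⟨y, hy', u', rfl⟩

theorem proj_map_eq {x y : E} {α β : ρ.OrbitCat} (hx : ρ.toOrbit x = α) (hy : ρ.toOrbit y = β)
    (u : x ⟶ y) :
    ρ.proj.map u = eqToHom hx ≫ (show α ⟶ β from ρ.cls hx hy u) ≫ eqToHom hy.symm := by
  subst hx hy
  simp [proj]

theorem act_comp_proj (g : G) : ρ.act g ⋙ ρ.proj = ρ.proj := by
  refine CategoryTheory.Functor.ext (fun x => ρ.toOrbit_obj g x) fun x y u => ?_
  refine (ρ.proj_map_eq (ρ.toOrbit_obj g x) (ρ.toOrbit_obj g y) ((ρ.act g).map u)).trans ?_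
  rw [cls_act]
  rfl

instance : ρ.proj.Additive where
  map_add {_ _} f g := map_add (ρ.cls _ _) f g

instance : ρ.proj.Linear k where
  map_smul {_ _} f a := map_smul (ρ.cls _ _) a f

end FreeGCategory

/-! ### Galois coverings -/

/-- The description of a Galois covering `F` by the decomposition of the spaces `B(F x, F y)`: the
sum of the spaces `E(x, y')`, where `y'` runs through the fibre of `F y`, is direct and equal to
`B(F x, F y)`. -/
structure CoveringDecomposition {k : Type w} [Field k] {G : Type u₃} [Group G]
    {E : Type u₁} [Category.{v₁} E] [Preadditive E] [Linear k E]
    {B : Type u₂} [Category.{v₂} B] [Preadditive B] [Linear k B]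
    (ρ : FreeGCategory k G E) (F : E ⥤ B) where
  additive : F.Additive
  linear : F.Linear k
  surjective : Function.Surjective F.obj
  obj_eq_iff : ∀ x y : E, F.obj x = F.obj y ↔ ∃ g : G, (ρ.act g).obj x = y
  act_comp : ∀ g : G, ρ.act g ⋙ F = F
  comp : ∀ x y : E, (F.obj x ⟶ F.obj y) →ₗ[k] (x ⟶ y)
  comp_map : ∀ {x y : E} (f : x ⟶ y), comp x y (F.map f) = f
  comp_of_ne : ∀ {x y y' : E} (f : x ⟶ y') (h : F.obj y' = F.obj y), y' ≠ y →
    comp x y (F.map f ≫ eqToHom h) = 0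
  span : ∀ (x : E) (c : B), Submodule.span k {b : F.obj x ⟶ c | ∃ (y : E) (h : F.obj y = c)
    (f : x ⟶ y), b = F.map f ≫ eqToHom h} = ⊤

/-- The isomorphism `E/G ≅ B` transports the components of `E/G`. The rest of the argument uses only
the resulting decomposition and the action on `E`, no longer the orbit category. -/
theorem IsGaloisCovering.nonempty_decomposition {k : Type w} [Field k] {G : Type u₃} [Group G]
    {E : Type u₁} [Category.{v₁} E] [Preadditive E] [Linear k E]
    {B : Type u₂} [Category.{v₂} B] [Preadditive B] [Linear k B]
    {ρ : FreeGCategory k G E} {F : E ⥤ B} (hF : IsGaloisCovering ρ F) :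
    Nonempty (CoveringDecomposition ρ F) := by
  obtain ⟨Φ, hadd, hlin, hiso, rfl⟩ := hF
  let e : ∀ α β : ρ.OrbitCat, ρ.QuotHom α β ≃ₗ[k] (Φ.obj α ⟶ Φ.obj β) := fun α β =>
    LinearEquiv.ofBijective (Φ.mapLinearMap k (X := α) (Y := β)) (hiso.bijective_map α β)
  have he : ∀ {α β : ρ.OrbitCat} (f : α ⟶ β), (e α β).symm (Φ.map f) = f := fun f =>
    (e _ _).symm_apply_apply f
  have hmap : ∀ {x y : E} {β : ρ.OrbitCat} (hy : ρ.toOrbit y = β)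
      (hy' : Φ.obj (ρ.toOrbit y) = Φ.obj β)
      (u : x ⟶ y), Φ.map (ρ.proj.map u) ≫ eqToHom hy' =
        Φ.map (show ρ.toOrbit x ⟶ β from ρ.cls rfl hy u) := by
    intro x y β hy hy' u
    subst hy
    simp [FreeGCategory.proj]
  refine ⟨{
    additive := inferInstance
    linear := inferInstance
    surjective := fun b => ?_
    obj_eq_iff := fun x y => ⟨fun h => ?_, ?_⟩
    act_comp := fun g => ?_
    comp := fun x y => ρ.component x y ∘ₗ (e (ρ.toOrbit x) (ρ.toOrbit y)).symm.toLinearMap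
    comp_map := fun {x y} f => ?_
    comp_of_ne := fun {x y y'} f h hne => ?_
    span := fun x c => ?_ }⟩
  · obtain ⟨α, rfl⟩ := hiso.bijective_obj.2 b
    obtain ⟨x, rfl⟩ := ρ.toOrbit_surjective α
    exact ⟨x, rfl⟩
  · exact ρ.exists_of_toOrbit_eq (hiso.bijective_obj.1 h)
  · rintro ⟨g, rfl⟩
    exact congrArg Φ.obj (ρ.toOrbit_obj g x).symm
  · rw [← Functor.assoc, ρ.act_comp_proj]
  · refine (congrArg (ρ.component x y) (he (ρ.proj.map f))).trans ?_
    exact (ρ.component_cls rfl rfl f).trans (ρ.transport_self f)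
  · have hy : ρ.toOrbit y' = ρ.toOrbit y := hiso.bijective_obj.1 h
    refine (congrArg (ρ.component x y) ((congrArg (e _ _).symm (hmap hy h f)).trans
      (he _))).trans ?_
    refine (ρ.component_cls rfl hy f).trans ?_
    rw [ρ.transport_of_ne hne, LinearMap.zero_apply]
  · obtain ⟨β, rfl⟩ := hiso.bijective_obj.2 c
    have := congrArg (Submodule.map (e (ρ.toOrbit x) β).toLinearMap) (ρ.span_cls x β)
    rw [Submodule.map_top, LinearEquiv.range, Submodule.map_span] at this
    refine eq_top_iff.2 (this.ge.trans (Submodule.span_mono ?_))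
    rintro _ ⟨_, ⟨y, hy, u, rfl⟩, rfl⟩
    exact ⟨y, congrArg Φ.obj hy, u, (hmap hy _ u).symm⟩

/-! ### Lifts of homogeneous arrows -/

section LiftArrow

variable {E : Type u₁} [Category.{v₁} E] {B : Type u₂} [Category.{v₂} B] {F : E ⥤ B}
  {A : B → B → Type v} (arr : ∀ b c : B, A b c → (b ⟶ c))

/-- The arrows from `x` to `y` of the covering quiver: the arrows from `F x` to `F y` whose image
in `B` is the image of a morphism from `x` to `y`. -/
def LiftArrow (F : E ⥤ B) {A : B → B → Type v} (arr : ∀ b c : B, A b c → (b ⟶ c)) (x y : E) :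
    Type v :=
  {a : A (F.obj x) (F.obj y) // ∃ f : x ⟶ y, F.map f = arr (F.obj x) (F.obj y) a}

variable (F) in
/-- The morphism which lifts the image of an arrow. -/
def liftArr (x y : E) (a : LiftArrow F arr x y) : x ⟶ y := a.2.choose

theorem map_liftArr {x y : E} (a : LiftArrow F arr x y) :
    F.map (liftArr F arr x y a) = arr (F.obj x) (F.obj y) a.1 := a.2.choose_spec

end LiftArrow

namespace CoveringDecomposition

variable {k : Type w} [Field k] {G : Type u₃} [Group G]
    {E : Type u₁} [Category.{v₁} E] [Preadditive E] [Linear k E]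
    {B : Type u₂} [Category.{v₂} B] [Preadditive B] [Linear k B]
    {ρ : FreeGCategory k G E} {F : E ⥤ B}

/-! ### Decomposition of morphisms and the radical -/

theorem hom_induction (D : CoveringDecomposition ρ F) {x : E} {c : B} {P : (F.obj x ⟶ c) → Prop}
    (zero : P 0)
    (add : ∀ b b', P b → P b' → P (b + b')) (smul : ∀ (a : k) b, P b → P (a • b))
    (map : ∀ (y : E) (h : F.obj y = c) (f : x ⟶ y), P (F.map f ≫ eqToHom h))
    (b : F.obj x ⟶ c) : P b := by
  have hb : b ∈ Submodule.span k {b : F.obj x ⟶ c | ∃ (y : E) (h : F.obj y = c)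
    (f : x ⟶ y), b = F.map f ≫ eqToHom h} := by rw [D.span]; exact Submodule.mem_top
  induction hb using Submodule.span_induction with
  | mem b hb =>
    obtain ⟨y, h, f, rfl⟩ := hb
    exact map y h f
  | zero => exact zero
  | add b b' _ _ h h' => exact add b b' h h'
  | smul a b _ h => exact smul a b h

/-- By linearity `b` may be taken homogeneous, and composing it with `F f` does not change the
object of the fibre at which it ends. -/
theorem comp_map_comp (D : CoveringDecomposition ρ F) {x y z : E} (f : x ⟶ y)
    (b : F.obj y ⟶ F.obj z) :
    D.comp x z (F.map f ≫ b) = f ≫ D.comp y z b := by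
  induction b using D.hom_induction with
  | zero => simp
  | add b b' h h' => rw [Preadditive.comp_add, map_add, map_add, h, h', Preadditive.comp_add]
  | smul a b h => rw [Linear.comp_smul, map_smul, map_smul, h, Linear.comp_smul]
  | map z' e h =>
    rw [← Category.assoc, ← F.map_comp]
    by_cases hz : z' = z
    · subst hz
      simp only [eqToHom_refl, Category.comp_id, D.comp_map]
    · rw [D.comp_of_ne _ e hz, D.comp_of_ne _ e hz, Limits.comp_zero]

theorem map_injective (D : CoveringDecomposition ρ F) {x y : E} {f f' : x ⟶ y}
    (h : F.map f = F.map f') : f = f' := by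
  rw [← D.comp_map f, h, D.comp_map]

theorem map_zero' (D : CoveringDecomposition ρ F) (x y : E) : F.map (0 : x ⟶ y) = 0 := by
  have := D.additive
  exact F.map_zero x y

/-- The component of the inverse is a one-sided inverse by `comp_map_comp`, which suffices over
local endomorphism rings. -/
theorem isIso_of_isIso_map (D : CoveringDecomposition ρ F) (hE : IsLocallyBounded k E) {x y : E}
    (f : x ⟶ y)
    (hf : IsIso (F.map f)) : IsIso f := by
  refine hE.isIso_of_comp_eq_id (h := D.comp y x (inv (F.map f))) ?_
  rw [← D.comp_map_comp, IsIso.hom_inv_id, ← F.map_id, D.comp_map]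

theorem map_mem_radical_iff (D : CoveringDecomposition ρ F) (hE : IsLocallyBounded k E)
    (hB : IsLocallyBounded k B) {x y : E}
    (f : x ⟶ y) : F.map f ∈ radical k (F.obj x) (F.obj y) ↔ f ∈ radical k x y := by
  rw [mem_radical_iff hE, mem_radical_iff hB, not_iff_not]
  exact ⟨D.isIso_of_isIso_map hE f, fun _ => inferInstance⟩

theorem map_mem_radicalSq (D : CoveringDecomposition ρ F) (hE : IsLocallyBounded k E)
    (hB : IsLocallyBounded k B) {x y : E}
    {f : x ⟶ y} (hf : f ∈ radicalSq k x y) : F.map f ∈ radicalSq k (F.obj x) (F.obj y) := by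
  have := D.additive
  have := D.linear
  induction hf using Submodule.span_induction with
  | mem f hf =>
    obtain ⟨z, f, g, hf, hg, rfl⟩ := hf
    exact Submodule.subset_span ⟨F.obj z, F.map f, F.map g, (D.map_mem_radical_iff hE hB f).2 hf,
      (D.map_mem_radical_iff hE hB g).2 hg, F.map_comp f g⟩
  | zero => rw [F.map_zero]; exact zero_mem _
  | add f f' _ _ h h' => rw [F.map_add]; exact add_mem h h'
  | smul a f _ h => rw [F.map_smul]; exact Submodule.smul_mem _ _ h

variable (k F) in
/-- The morphisms `F f` with `f` in the radical. -/
def homogeneousRadical (x : E) (c : B) : Set (F.obj x ⟶ c) :=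
  {b | ∃ (y : E) (h : F.obj y = c) (f : x ⟶ y), f ∈ radical k x y ∧ b = F.map f ≫ eqToHom h}

theorem homogeneousRadical_subset (D : CoveringDecomposition ρ F) (hE : IsLocallyBounded k E)
    (hB : IsLocallyBounded k B) (x : E)
    (c : B) : homogeneousRadical k F x c ⊆ radical k (F.obj x) c := by
  rintro _ ⟨y, rfl, f, hf, rfl⟩
  rw [eqToHom_refl, Category.comp_id]
  exact (D.map_mem_radical_iff hE hB f).2 hf

/-- The components removed end at objects `y ≠ x`, and morphisms between distinct objects of `E` are
always radical. -/
theorem sub_map_comp_mem (D : CoveringDecomposition ρ F) (hE : IsLocallyBounded k E) {x : E}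
    (b : F.obj x ⟶ F.obj x) :
    b - F.map (D.comp x x b) ∈ Submodule.span k (homogeneousRadical k F x (F.obj x)) := by
  have := D.additive
  have := D.linear
  induction b using D.hom_induction with
  | zero => simp
  | add b b' h h' => rw [map_add, F.map_add, add_sub_add_comm]; exact add_mem h h'
  | smul a b h => rw [map_smul, F.map_smul, ← smul_sub]; exact Submodule.smul_mem _ _ h
  | map y e f =>
    by_cases hy : y = x
    · subst hy
      simp [D.comp_map]
    · rw [D.comp_of_ne f e hy, F.map_zero, sub_zero]
      exact Submodule.subset_span ⟨y, e, f, hE.mem_radical_of_ne (Ne.symm hy) f, rfl⟩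

/-- Only `x = y` needs an argument: there `F` of the component differs from `b` by a radical
element, and `F` reflects the radical. -/
theorem comp_mem_radical (D : CoveringDecomposition ρ F) (hE : IsLocallyBounded k E)
    (hB : IsLocallyBounded k B) {x y : E}
    {b : F.obj x ⟶ F.obj y} (hb : b ∈ radical k (F.obj x) (F.obj y)) :
    D.comp x y b ∈ radical k x y := by
  by_cases hxy : x = y
  · subst hxy
    have h := Submodule.span_le.2 (D.homogeneousRadical_subset hE hB x _) (D.sub_map_comp_mem hE b)
    exact (D.map_mem_radical_iff hE hB _).1 ((Submodule.sub_mem_iff_right _ hb).1 h)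
  · exact hE.mem_radical_of_ne hxy _

/-- Off-diagonal components are radical automatically; a diagonal one, present only when `F x = c`,
is radical by `comp_mem_radical`. -/
theorem radical_le_span (D : CoveringDecomposition ρ F) (hE : IsLocallyBounded k E)
    (hB : IsLocallyBounded k B) (x : E) (c : B) :
    radical k (F.obj x) c ≤ Submodule.span k (homogeneousRadical k F x c) := by
  intro b hb
  by_cases hc : F.obj x = c
  · subst hc
    rw [← sub_add_cancel b (F.map (D.comp x x b))]
    refine add_mem (D.sub_map_comp_mem hE b) (Submodule.subset_span ⟨x, rfl, D.comp x x b,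
      D.comp_mem_radical hE hB hb, ?_⟩)
    simp
  · clear hb
    induction b using D.hom_induction with
    | zero => exact zero_mem _
    | add b b' h h' => exact add_mem h h'
    | smul a b h => exact Submodule.smul_mem _ _ h
    | map y e f =>
      refine Submodule.subset_span ⟨y, e, f, hE.mem_radical_of_ne ?_ f, rfl⟩
      rintro rfl
      exact hc e

/-- Decompose the first factor of a product into homogeneous radical pieces `F f`; then
`comp_map_comp` pulls `f` out and leaves the component of the second factor, again radical. -/
theorem comp_mem_radicalSq (D : CoveringDecomposition ρ F) (hE : IsLocallyBounded k E)
    (hB : IsLocallyBounded k B) {x y : E}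
    {b : F.obj x ⟶ F.obj y} (hb : b ∈ radicalSq k (F.obj x) (F.obj y)) :
    D.comp x y b ∈ radicalSq k x y := by
  induction hb using Submodule.span_induction with
  | mem b hb =>
    obtain ⟨d, f, g, hf, hg, rfl⟩ := hb
    replace hf := D.radical_le_span hE hB x d hf
    induction hf using Submodule.span_induction with
    | mem f hf =>
      obtain ⟨z, rfl, f, hf, rfl⟩ := hf
      rw [eqToHom_refl, Category.comp_id, D.comp_map_comp]
      exact Submodule.subset_span ⟨z, f, D.comp z y g, hf, D.comp_mem_radical hE hB hg, rfl⟩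
    | zero => simp
    | add f f' _ _ h h' => rw [Preadditive.add_comp, map_add]; exact add_mem h h'
    | smul a f _ h => rw [Linear.smul_comp, map_smul]; exact Submodule.smul_mem _ _ h
  | zero => simp
  | add f f' _ _ h h' => rw [map_add]; exact add_mem h h'
  | smul a f _ h => rw [map_smul]; exact Submodule.smul_mem _ _ h

/-! ### Lifts of homogeneous morphisms -/

theorem obj_act (D : CoveringDecomposition ρ F) (g : G) (x : E) : F.obj ((ρ.act g).obj x)
    = F.obj x :=
  Functor.congr_obj (D.act_comp g) x

theorem map_act (D : CoveringDecomposition ρ F) (g : G) {x y : E} (u : x ⟶ y) :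
    F.map ((ρ.act g).map u) =
    eqToHom (D.obj_act g x) ≫ F.map u ≫ eqToHom (D.obj_act g y).symm :=
  Functor.congr_hom (D.act_comp g) u

/-- Otherwise the component at `y'` of one and the same morphism would be both `f'` and zero. -/
theorem target_unique (D : CoveringDecomposition ρ F) {x y y' : E} (f : x ⟶ y) (f' : x ⟶ y')
    (h : F.obj y = F.obj y')
    (e : F.map f ≫ eqToHom h = F.map f') (h0 : F.map f' ≠ 0) : y = y' := by
  by_contra hne
  have := D.comp_of_ne f h hne
  rw [e, D.comp_map] at this
  rw [this] at h0
  exact h0 (D.map_zero' _ _)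

/-- The decomposition fixes the source, so `f` is first translated to start at `x'`. Uniqueness of
targets then shows that the translating element fixes `y`, and freeness makes it trivial. -/
theorem source_unique (D : CoveringDecomposition ρ F) {x x' y : E} (f : x ⟶ y) (f' : x' ⟶ y)
    (h : F.obj x = F.obj x')
    (e : F.map f = eqToHom h ≫ F.map f') (h0 : F.map f' ≠ 0) : x = x' := by
  obtain ⟨g, rfl⟩ := (D.obj_eq_iff x x').1 h
  have hy : (ρ.act g).obj y = y := by
    refine D.target_unique ((ρ.act g).map f) f' (D.obj_act g y) ?_ h0
    rw [D.map_act, e]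
    simp
  rw [ρ.free g y hy, ρ.one_obj]

variable (F) in
/-- A morphism of `B` is homogeneous if it is of the form `F f`. -/
def IsHomogeneous {b c : B} (u : b ⟶ c) : Prop :=
  ∃ (x y : E) (hx : F.obj x = b) (hy : F.obj y = c) (f : x ⟶ y),
    u = eqToHom hx.symm ≫ F.map f ≫ eqToHom hy

/-- Homogeneity does not depend on the object chosen over the source: `G` permutes the fibre
transitively, and translates of `f` have the same image up to identification of objects. -/
theorem exists_lift_source (D : CoveringDecomposition ρ F) {x : E} {c : B} {u : F.obj x ⟶ c}
    (hu : IsHomogeneous F u) :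
    ∃ (y : E) (hy : F.obj y = c) (f : x ⟶ y), F.map f ≫ eqToHom hy = u := by
  obtain ⟨x₀, y₀, hx, rfl, f, rfl⟩ := hu
  obtain ⟨g, rfl⟩ := (D.obj_eq_iff x₀ x).1 hx
  refine ⟨(ρ.act g).obj y₀, D.obj_act g y₀, (ρ.act g).map f, ?_⟩
  rw [D.map_act]
  simp

theorem exists_lift_target (D : CoveringDecomposition ρ F) {y : E} {b : B} {u : b ⟶ F.obj y}
    (hu : IsHomogeneous F u) :
    ∃ (x : E) (hx : F.obj x = b) (f : x ⟶ y), eqToHom hx.symm ≫ F.map f = u := by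
  obtain ⟨x₀, y₀, rfl, hy, f, rfl⟩ := hu
  obtain ⟨g, rfl⟩ := (D.obj_eq_iff y₀ y).1 hy
  refine ⟨(ρ.act g).obj x₀, D.obj_act g x₀, (ρ.act g).map f, ?_⟩
  rw [D.map_act]
  simp

/-! ### Homogeneous bases of the radical modulo its square -/

theorem exists_fin_basis (D : CoveringDecomposition ρ F) (hE : IsLocallyBounded k E)
    (hB : IsLocallyBounded k B) (b c : B) :
    ∃ (n : ℕ) (arr : Fin n → (b ⟶ c)), (∀ a, arr a ∈ radical k b c) ∧
      LinearIndependent k (fun a => (radicalSq k b c).mkQ (arr a)) ∧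
      radical k b c ≤ Submodule.span k (Set.range arr) ⊔ radicalSq k b c ∧
      ∀ a, IsHomogeneous F (arr a) := by
  obtain ⟨x, rfl⟩ := D.surjective b
  have := hB.finite_hom (F.obj x) c
  let N := radicalSq k (F.obj x) c
  -- The classes of homogeneous radical morphisms span the radical modulo its square, so a basis can
  -- be extracted from them and each basis vector lifted to a homogeneous morphism.
  obtain ⟨s, hs, hspan, hli⟩ := exists_linearIndependent k (N.mkQ '' homogeneousRadical k F x c)
  have hfin : Finite s := hli.finite
  obtain ⟨n, ⟨e⟩⟩ := Finite.exists_equiv_fin s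
  choose arr harr hmk using fun a : Fin n => hs (e.symm a).2
  have hrange : Set.range (fun a => N.mkQ (arr a)) = s := by
    ext v
    constructor
    · rintro ⟨a, rfl⟩
      simp only [hmk]
      exact (e.symm a).2
    · intro hv
      exact ⟨e ⟨v, hv⟩, by simp only [hmk, Equiv.symm_apply_apply]⟩
  refine ⟨n, arr, fun a => D.homogeneousRadical_subset hE hB x c (harr a), ?_, fun b hb => ?_,
    fun a => ?_⟩
  · have : (fun a => N.mkQ (arr a)) = Subtype.val ∘ e.symm := funext fun a => hmk a
    exact this ▸ hli.comp _ e.symm.injective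
  · have h1 : N.mkQ b ∈ Submodule.span k s := by
      rw [hspan, Submodule.span_image]
      exact ⟨b, D.radical_le_span hE hB x c hb, rfl⟩
    rw [← hrange, Set.range_comp' N.mkQ arr, Submodule.span_image] at h1
    have h2 : b ∈ ((Submodule.span k (Set.range arr)).map N.mkQ).comap N.mkQ := h1
    rwa [Submodule.comap_map_mkQ, sup_comm] at h2
  · obtain ⟨y, h, f, -, e⟩ := harr a
    exact ⟨x, y, rfl, h, f, by rw [e, eqToHom_refl, Category.id_comp]⟩

theorem exists_homogeneous_arrowBasis (D : CoveringDecomposition ρ F) (hE : IsLocallyBounded k E)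
    (hB : IsLocallyBounded k B) :
    ∃ (A : B → B → Type) (arr : ∀ b c : B, A b c → (b ⟶ c)), IsArrowBasis k A arr ∧
      ∀ (b c : B) (a : A b c), IsHomogeneous F (arr b c a) := by
  choose n arr hmem hli hspan hhom using D.exists_fin_basis hE hB
  exact ⟨fun b c => Fin (n b c), arr, ⟨hmem, hli, hspan⟩, hhom⟩

/-! ### The induced basis upstairs -/

variable {A : B → B → Type v} {arr : ∀ b c : B, A b c → (b ⟶ c)}

/-- Independence: `F` sends distinct lifts to distinct members of the basis downstairs. Spanning:
expand `F f` downstairs and apply `comp`, which sends each arrow to its lift or to zero and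
preserves the square of the radical. -/
theorem isArrowBasis_liftArr (D : CoveringDecomposition ρ F) (hE : IsLocallyBounded k E)
    (hB : IsLocallyBounded k B)
    (hA : IsArrowBasis k A arr) (hhom : ∀ (b c : B) (a : A b c), IsHomogeneous F (arr b c a)) :
    IsArrowBasis k (LiftArrow F arr) (liftArr F arr) where
  mem x y a := by
    rw [← D.map_mem_radical_iff hE hB, map_liftArr]
    exact hA.mem _ _ _
  linearIndependent x y := by
    have := D.additive
    have := D.linear
    let T : ((x ⟶ y) ⧸ radicalSq k x y) →ₗ[k]
        (F.obj x ⟶ F.obj y) ⧸ radicalSq k (F.obj x) (F.obj y) :=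
      Submodule.mapQ _ _ (F.mapLinearMap k) fun f hf => D.map_mem_radicalSq hE hB hf
    refine LinearIndependent.of_comp T ?_
    have h := (hA.linearIndependent (F.obj x) (F.obj y)).comp
      (fun a : LiftArrow F arr x y => a.1) Subtype.val_injective
    have e : T ∘ (fun a => (radicalSq k x y).mkQ (liftArr F arr x y a)) =
        (fun a => (radicalSq k (F.obj x) (F.obj y)).mkQ (arr _ _ a)) ∘
          fun a : LiftArrow F arr x y => a.1 :=
      funext fun a => congrArg (radicalSq k (F.obj x) (F.obj y)).mkQ (map_liftArr arr a)
    rw [e]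
    exact h
  le_span x y f hf := by
    have h := hA.le_span _ _ ((D.map_mem_radical_iff hE hB f).2 hf)
    have h' := Submodule.mem_map_of_mem (f := D.comp x y) h
    rw [D.comp_map, Submodule.map_sup] at h'
    refine SetLike.le_def.1 (sup_le_sup ?_ ?_) h'
    · rw [Submodule.map_span, Submodule.span_le]
      rintro _ ⟨_, ⟨a, rfl⟩, rfl⟩
      obtain ⟨y', hy, f', e⟩ := D.exists_lift_source (hhom _ _ a)
      rw [SetLike.mem_coe, ← e]
      by_cases hyy : y' = y
      · subst hyy
        rw [eqToHom_refl, Category.comp_id] at e ⊢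
        refine Submodule.subset_span ⟨⟨a, f', e⟩, ?_⟩
        rw [D.comp_map]
        exact D.map_injective ((map_liftArr arr _).trans e.symm)
      · rw [D.comp_of_ne _ _ hyy]
        exact zero_mem _
    · rintro _ ⟨b, hb, rfl⟩
      exact D.comp_mem_radicalSq hE hB hb

end CoveringDecomposition

/-! ### Functoriality of path categories -/

theorem Prefunctor.ext_of_heq {V : Type u} [Quiver.{v} V] {W : Type u₁} [Quiver.{v₁} W]
    {p q : V ⥤q W} (hobj : ∀ x, p.obj x = q.obj x)
    (hmap : ∀ (x y : V) (a : x ⟶ y), HEq (p.map a) (q.map a)) : p = q := by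
  obtain ⟨pobj, pmap⟩ := p
  obtain ⟨qobj, qmap⟩ := q
  obtain rfl : pobj = qobj := funext hobj
  congr
  funext x y a
  exact eq_of_heq (hmap x y a)

namespace PathCat

variable {k : Type w} [Field k] {V : Type u} [Quiver.{v} V] {W : Type u₃} [Quiver.{v₃} W]
  {C : Type u₁} [Category.{v₁} C] [Preadditive C] [Linear k C]
  {D : Type u₂} [Category.{v₂} D] [Preadditive D] [Linear k D]

theorem linearMap_ext {M : Type*} [AddCommGroup M] [Module k M] {x y : PathCat k V}
    {f g : (x ⟶ y) →ₗ[k] M} (h : ∀ q : Quiver.Path x.pt y.pt, f (ofPath q) = g (ofPath q)) :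
    f = g := by
  ext r
  induction r using hom_induction with
  | zero => rw [map_zero, map_zero]
  | add r r' h h' => rw [map_add, map_add, h, h']
  | smul_ofPath a q => rw [map_smul, map_smul, h]

theorem composePath_mapPath_comp {C : Type u₁} [Category.{v₁} C] {D : Type u₂} [Category.{v₂} D]
    (φ : V ⥤q C) (H : C ⥤ D) {x y : V} (q : Quiver.Path x y) :
    composePath ((φ ⋙q H.toPrefunctor).mapPath q) = H.map (composePath (φ.mapPath q)) := by
  induction q with
  | nil => exact (H.map_id _).symm
  | cons q b ih => exact (congrArg (· ≫ H.map (φ.map b)) ih).trans (H.map_comp _ _).symm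

/-- Together with `map_comp_lift`, this reduces identities between linear functors on path
categories to identities between morphisms of quivers. -/
theorem lift_comp (φ : V ⥤q C) (H : C ⥤ D) [H.Additive] [H.Linear k] :
    lift k (φ ⋙q H.toPrefunctor) = lift k φ ⋙ H := by
  refine CategoryTheory.Functor.hext (fun _ => rfl) fun x y f => heq_of_eq ?_
  have h : liftHom k (φ ⋙q H.toPrefunctor) x y = H.mapLinearMap k ∘ₗ liftHom k φ x y :=
    linearMap_ext fun q => (liftHom_ofPath _ q).trans ((composePath_mapPath_comp φ H q).trans
      (congrArg (fun f => H.map f) (liftHom_ofPath φ q).symm))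
  exact LinearMap.congr_fun h f

theorem map_comp_lift (p : V ⥤q W) (χ : W ⥤q C) :
    lift k (p ⋙q χ) = map k p ⋙ lift k χ := by
  refine CategoryTheory.Functor.hext (fun _ => rfl) fun x y f => heq_of_eq ?_
  have h : liftHom k (p ⋙q χ) x y =
      liftHom k χ ((map k p).obj x) ((map k p).obj y) ∘ₗ (map k p).mapLinearMap k :=
    linearMap_ext fun q => (liftHom_ofPath _ q).trans
      ((congrArg composePath (Prefunctor.mapPath_comp_apply p χ q)).trans
        ((liftHom_ofPath (x := (map k p).obj x) (y := (map k p).obj y) χ (p.mapPath q)).symm.trans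
          (congrArg (liftHom k χ _ _) (map_map_ofPath p q).symm)))
  exact LinearMap.congr_fun h f

theorem map_comp {W' : Type u₁} [Quiver.{v₁} W'] (p : V ⥤q W) (q : W ⥤q W') :
    map k (p ⋙q q) = map k p ⋙ map k q := by
  refine CategoryTheory.Functor.hext (fun _ => rfl) fun x y f => heq_of_eq ?_
  have h : (map k (p ⋙q q)).mapLinearMap k (X := x) (Y := y) =
      (map k q).mapLinearMap k ∘ₗ (map k p).mapLinearMap k :=
    linearMap_ext fun r => (map_map_ofPath (p ⋙q q) r).trans
      ((congrArg ofPath (Prefunctor.mapPath_comp_apply p q r)).trans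
        ((map_map_ofPath (x := (map k p).obj x) (y := (map k p).obj y) q (p.mapPath r)).symm.trans
          (congrArg (fun f => (map k q).map f) (map_map_ofPath p r).symm)))
  exact LinearMap.congr_fun h f

end PathCat

/-! ### The covering of quivers -/

section Cover

variable {E : Type u₁} [Category.{v₁} E] {B : Type u₂} [Category.{v₂} B]
  {A : B → B → Type v} (arr : ∀ b c : B, A b c → (b ⟶ c))

variable {arr} in
theorem arr_comp_eqToHom {b c c' : B} (h : c = c') {a : A b c} {a' : A b c'} (e : HEq a a') :
    arr b c a ≫ eqToHom h = arr b c' a' := by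
  subst h
  rw [eq_of_heq e, eqToHom_refl, Category.comp_id]

variable {arr} in
theorem arr_eq_eqToHom_comp {b b' c : B} (h : b = b') {a : A b c} {a' : A b' c} (e : HEq a a') :
    arr b c a = eqToHom h ≫ arr b' c a' := by
  subst h
  rw [eq_of_heq e, eqToHom_refl, Category.id_comp]

theorem arr_cast {b c b' c' : B} (hb : b = b') (hc : c = c') (a : A b c) :
    arr b' c' (cast (congrArg₂ A hb hc) a) = eqToHom hb.symm ≫ arr b c a ≫ eqToHom hc := by
  subst hb hc
  simp

variable (F : E ⥤ B)

/-- The projection of the covering quiver. -/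
abbrev coverPrefunctor : Vert (LiftArrow F arr) ⥤q Vert A where
  obj x := ⟨F.obj x.pt⟩
  map a := a.1

theorem arrowPrefunctor_comp_eq :
    arrowPrefunctor (liftArr F arr) ⋙q F.toPrefunctor =
      coverPrefunctor arr F ⋙q arrowPrefunctor arr :=
  Prefunctor.ext_of_heq (fun _ => rfl) fun _ _ a => heq_of_eq (map_liftArr arr a)

variable {arr} in
theorem composePath_arr_comp_eqToHom {b c c' : B} (h : c = c') {q : Quiver.Path (⟨b⟩ : Vert A) ⟨c⟩}
    {q' : Quiver.Path (⟨b⟩ : Vert A) ⟨c'⟩} (e : HEq q q') :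
    (composePath ((arrowPrefunctor arr).mapPath q) : b ⟶ c) ≫ eqToHom h =
      composePath ((arrowPrefunctor arr).mapPath q') := by
  subst h
  rw [eq_of_heq e]
  exact Category.comp_id _

variable {arr F} in
theorem map_composePath_liftArr {x y : Vert (LiftArrow F arr)} (q : Quiver.Path x y) :
    F.map (composePath ((arrowPrefunctor (liftArr F arr)).mapPath q)) =
      composePath ((arrowPrefunctor arr).mapPath ((coverPrefunctor arr F).mapPath q)) := by
  induction q with
  | nil => exact F.map_id _
  | cons q a ih =>
    refine (F.map_comp _ _).trans ?_
    rw [ih]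
    exact congrArg (_ ≫ ·) (map_liftArr arr a)

variable {arr F} in
theorem LiftArrow.heq {x y x' y' : E} (hx : x = x') (hy : y = y') {a : LiftArrow F arr x y}
    {a' : LiftArrow F arr x' y'} (h : HEq a.1 a'.1) : HEq a a' := by
  subst hx hy
  exact heq_of_eq (Subtype.ext (eq_of_heq h))

end Cover

/-- Evaluation being surjective, a nonzero morphism forces a path between its ends, and a path is a
walk in the quiver. -/
theorem IsArrowBasis.isConnectedQuiver {k : Type w} [Field k] [IsAlgClosed k] {C : Type u}
    [Category.{v} C] [Preadditive C] [Linear k C] {A : C → C → Type v₁}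
    {arr : ∀ x y : C, A x y → (x ⟶ y)} (hA : IsArrowBasis k A arr) (hC : IsLocallyBounded k C)
    (hconn : IsConnectedLinearCategory C) : IsConnectedQuiver (Vert A) := by
  have hpath : ∀ {a b : Vert A} (_ : Quiver.Path a b), Relation.ReflTransGen
      (fun a b : Vert A => Nonempty (a ⟶ b) ∨ Nonempty (b ⟶ a)) a b := by
    intro a b q
    induction q with
    | nil => exact .refl
    | cons _ e ih => exact ih.tail (.inl ⟨e⟩)
  have hpath' : ∀ {a b : Vert A} (_ : Quiver.Path a b), Relation.ReflTransGen
      (fun a b : Vert A => Nonempty (a ⟶ b) ∨ Nonempty (b ⟶ a)) b a := by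
    intro a b q
    induction q with
    | nil => exact .refl
    | cons _ e ih => exact .head (.inr ⟨e⟩) ih
  have hne : ∀ {a b : C} (f : a ⟶ b), f ≠ 0 → Nonempty (Quiver.Path (⟨a⟩ : Vert A) ⟨b⟩) := by
    intro a b f hf
    by_contra hempty
    rw [not_nonempty_iff] at hempty
    obtain ⟨r, rfl⟩ := hA.lift_map_surjective hC ⟨⟨a⟩⟩ ⟨⟨b⟩⟩ f
    have hr : r = 0 := Finsupp.ext fun q => hempty.elim q
    exact hf (hr ▸ (PathCat.lift k (arrowPrefunctor arr)).map_zero _ _)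
  refine ⟨hconn.1.map Vert.mk, fun ⟨x⟩ ⟨y⟩ => ?_⟩
  induction hconn.2 x y with
  | refl => exact .refl
  | tail _ h ih =>
    rcases h with ⟨f, hf⟩ | ⟨f, hf⟩
    · exact ih.trans (hpath (hne f hf).some)
    · exact ih.trans (hpath' (hne f hf).some)

/-! ### Evaluation and the covering; unique lifting of arrows -/

namespace CoveringDecomposition

variable {k : Type w} [Field k] {G : Type u₃} [Group G]
    {E : Type u₁} [Category.{v₁} E] [Preadditive E] [Linear k E]
    {B : Type u₂} [Category.{v₂} B] [Preadditive B] [Linear k B]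
    {ρ : FreeGCategory k G E} {F : E ⥤ B}
    {A : B → B → Type v} {arr : ∀ b c : B, A b c → (b ⟶ c)}

theorem lift_comp_eq (D : CoveringDecomposition ρ F) :
    PathCat.lift k (arrowPrefunctor (liftArr F arr)) ⋙ F =
      PathCat.map k (coverPrefunctor arr F) ⋙ PathCat.lift k (arrowPrefunctor arr) := by
  have := D.additive
  have := D.linear
  rw [← PathCat.lift_comp, ← PathCat.map_comp_lift, arrowPrefunctor_comp_eq]

theorem map_lift_map (D : CoveringDecomposition ρ F) {x y : PathCat k (Vert (LiftArrow F arr))}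
    (r : x ⟶ y) : F.map ((PathCat.lift k (arrowPrefunctor (liftArr F arr))).map r) =
      (PathCat.lift k (arrowPrefunctor arr)).map ((PathCat.map k (coverPrefunctor arr F)).map r) :=
  eq_of_heq (Functor.hcongr_hom D.lift_comp_eq r)

theorem mapsIdeal (D : CoveringDecomposition ρ F) : MapsIdeal (coverPrefunctor arr F)
    (CatIdeal.ker k (PathCat.lift k (arrowPrefunctor (liftArr F arr))))
    (CatIdeal.ker k (PathCat.lift k (arrowPrefunctor arr))) := by
  intro x y r hr
  rw [CatIdeal.mem_ker] at hr ⊢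
  rw [← D.map_lift_map, hr]
  exact D.map_zero' _ _

/-- Existence of lifts is homogeneity of the arrows; uniqueness is `target_unique`, applicable since
arrows are nonzero. -/
theorem bijective_star (D : CoveringDecomposition ρ F) (hA : IsArrowBasis k A arr)
    (hhom : ∀ (b c : B) (a : A b c), IsHomogeneous F (arr b c a)) (x : Vert (LiftArrow F arr)) :
    Function.Bijective ((coverPrefunctor arr F).star x) := by
  obtain ⟨x⟩ := x
  constructor
  · rintro ⟨⟨y⟩, a⟩ ⟨⟨y'⟩, a'⟩ h
    have h1 : F.obj y = F.obj y' := congrArg (fun s => s.1.pt) h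
    have h2 : HEq a.1 a'.1 := (Sigma.mk.inj h).2
    obtain rfl : y = y' := by
      refine D.target_unique (liftArr F arr x y a) (liftArr F arr x y' a') h1 ?_ ?_
      · rw [map_liftArr, map_liftArr]
        exact arr_comp_eqToHom h1 h2
      · rw [map_liftArr]
        exact hA.arr_ne_zero _
    exact congrArg (Sigma.mk _) (Subtype.ext (eq_of_heq h2))
  · rintro ⟨⟨c⟩, a⟩
    obtain ⟨y, h, f, e⟩ := D.exists_lift_source (x := x) (c := c) (hhom _ _ a)
    subst h
    rw [eqToHom_refl, Category.comp_id] at e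
    exact ⟨⟨⟨y⟩, ⟨a, f, e⟩⟩, rfl⟩

theorem bijective_costar (D : CoveringDecomposition ρ F) (hA : IsArrowBasis k A arr)
    (hhom : ∀ (b c : B) (a : A b c), IsHomogeneous F (arr b c a)) (y : Vert (LiftArrow F arr)) :
    Function.Bijective ((coverPrefunctor arr F).costar y) := by
  obtain ⟨y⟩ := y
  constructor
  · rintro ⟨⟨x⟩, a⟩ ⟨⟨x'⟩, a'⟩ h
    have h1 : F.obj x = F.obj x' := congrArg (fun s => s.1.pt) h
    have h2 : HEq a.1 a'.1 := (Sigma.mk.inj h).2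
    obtain rfl : x = x' := by
      refine D.source_unique (liftArr F arr x y a) (liftArr F arr x' y a') h1 ?_ ?_
      · rw [map_liftArr, map_liftArr]
        exact arr_eq_eqToHom_comp h1 h2
      · rw [map_liftArr]
        exact hA.arr_ne_zero _
    exact congrArg (Sigma.mk _) (Subtype.ext (eq_of_heq h2))
  · rintro ⟨⟨c⟩, a⟩
    obtain ⟨x, h, f, e⟩ := D.exists_lift_target (y := y) (b := c) (hhom _ _ a)
    subst h
    rw [eqToHom_refl, Category.id_comp] at e
    exact ⟨⟨⟨x⟩, ⟨a, f, e⟩⟩, rfl⟩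

/-! ### The group action on the covering quiver -/

/-- The translate by `g` of a lift of an arrow lifts the same arrow, up to identification of its
ends. Hence `G` acts on the covering quiver. -/
theorem arr_cast_act (D : CoveringDecomposition ρ F) (g : G) {x y : E} (a : LiftArrow F arr x y) :
    F.map ((ρ.act g).map (liftArr F arr x y a)) =
      arr _ _ (cast (congrArg₂ A (D.obj_act g x).symm (D.obj_act g y).symm) a.1) := by
  rw [D.map_act, map_liftArr]
  exact (arr_cast arr (D.obj_act g x).symm (D.obj_act g y).symm a.1).symm

/-- The automorphism of the covering quiver given by an element of `G`. -/
def actPrefunctor (D : CoveringDecomposition ρ F) (arr : ∀ b c : B, A b c → (b ⟶ c)) (g : G) :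
    Vert (LiftArrow F arr) ⥤q Vert (LiftArrow F arr) where
  obj x := ⟨(ρ.act g).obj x.pt⟩
  map {x y} a := ⟨cast (congrArg₂ A (D.obj_act g x.pt).symm (D.obj_act g y.pt).symm) a.1,
    (ρ.act g).map (liftArr F arr x.pt y.pt a), D.arr_cast_act g a⟩

theorem actPrefunctor_map_val_heq (D : CoveringDecomposition ρ F) (g : G)
    {x y : Vert (LiftArrow F arr)} (a : x ⟶ y) :
    HEq ((D.actPrefunctor arr g).map a).1 a.1 :=
  cast_heq _ _

theorem actPrefunctor_one (D : CoveringDecomposition ρ F) :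
    D.actPrefunctor arr 1 = 𝟭q (Vert (LiftArrow F arr)) :=
  Prefunctor.ext_of_heq (fun x => congrArg Vert.mk (ρ.one_obj x.pt)) fun x y a =>
    LiftArrow.heq (ρ.one_obj x.pt) (ρ.one_obj y.pt) (D.actPrefunctor_map_val_heq 1 a)

theorem actPrefunctor_mul (D : CoveringDecomposition ρ F) (g h : G) :
    D.actPrefunctor arr (g * h) = D.actPrefunctor arr h ⋙q D.actPrefunctor arr g :=
  Prefunctor.ext_of_heq (fun x => congrArg Vert.mk (ρ.mul_obj g h x.pt)) fun x y a =>
    LiftArrow.heq (ρ.mul_obj g h x.pt) (ρ.mul_obj g h y.pt)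
      ((D.actPrefunctor_map_val_heq (g * h) a).trans
        ((D.actPrefunctor_map_val_heq g _).trans (D.actPrefunctor_map_val_heq h a)).symm)

theorem actPrefunctor_comp_cover (D : CoveringDecomposition ρ F) (g : G) :
    D.actPrefunctor arr g ⋙q coverPrefunctor arr F = coverPrefunctor arr F :=
  Prefunctor.ext_of_heq (fun x => congrArg Vert.mk (D.obj_act g x.pt)) fun _ _ a =>
    D.actPrefunctor_map_val_heq g a

/-- Although lifts are obtained by choice, they are compatible with `G`: both sides have the same
image under `F`, which is faithful. -/
theorem arrowPrefunctor_comp_act (D : CoveringDecomposition ρ F) (g : G) :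
    arrowPrefunctor (liftArr F arr) ⋙q (ρ.act g).toPrefunctor =
      D.actPrefunctor arr g ⋙q arrowPrefunctor (liftArr F arr) :=
  Prefunctor.ext_of_heq (fun _ => rfl) fun _ _ a => heq_of_eq (D.map_injective
    ((D.arr_cast_act g a).trans (map_liftArr arr ((D.actPrefunctor arr g).map a)).symm))

theorem mapsIdeal_act (D : CoveringDecomposition ρ F) (g : G) : MapsIdeal (D.actPrefunctor arr g)
    (CatIdeal.ker k (PathCat.lift k (arrowPrefunctor (liftArr F arr))))
    (CatIdeal.ker k (PathCat.lift k (arrowPrefunctor (liftArr F arr)))) := by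
  intro x y r hr
  rw [CatIdeal.mem_ker] at hr ⊢
  have h : PathCat.lift k (arrowPrefunctor (liftArr F arr)) ⋙ ρ.act g =
      PathCat.map k (D.actPrefunctor arr g) ⋙
        PathCat.lift k (arrowPrefunctor (liftArr F arr)) := by
    rw [← PathCat.lift_comp, ← PathCat.map_comp_lift, arrowPrefunctor_comp_act]
  refine (eq_of_heq (Functor.hcongr_hom h r)).symm.trans ?_
  exact (congrArg (fun f => (ρ.act g).map f) hr).trans ((ρ.act g).map_zero _ _)

/-! ### Lifting of minimal relations -/

/-- Paths inherit unique lifting from arrows. -/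
theorem mapPath_injective (D : CoveringDecomposition ρ F) (hA : IsArrowBasis k A arr)
    (hhom : ∀ (b c : B) (a : A b c), IsHomogeneous F (arr b c a)) (x y : Vert (LiftArrow F arr)) :
    Function.Injective fun q : Quiver.Path x y => (coverPrefunctor arr F).mapPath q := by
  intro q q' h
  have := ((coverPrefunctor arr F).pathStar_bijective (D.bijective_star hA hhom) x).1
    (a₁ := ⟨y, q⟩) (a₂ := ⟨y, q'⟩) (congrArg (Sigma.mk _) h)
  exact eq_of_heq (Sigma.mk.inj this).2

/-- The part of a linear combination of paths from `F x` to `F y` which lifts to paths from `x`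
to `y`. -/
def restrict (D : CoveringDecomposition ρ F) (hA : IsArrowBasis k A arr)
    (hhom : ∀ (b c : B) (a : A b c), IsHomogeneous F (arr b c a))
    (x y : PathCat k (Vert (LiftArrow F arr))) :
    ((PathCat.map k (coverPrefunctor arr F)).obj x ⟶ (PathCat.map k (coverPrefunctor arr F)).obj y)
      →ₗ[k] (x ⟶ y) :=
  Finsupp.lcomapDomain (fun q : Quiver.Path x.pt y.pt => (coverPrefunctor arr F).mapPath q)
    (D.mapPath_injective hA hhom x.pt y.pt)

theorem restrict_ofPath (D : CoveringDecomposition ρ F) (hA : IsArrowBasis k A arr)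
    (hhom : ∀ (b c : B) (a : A b c), IsHomogeneous F (arr b c a))
    {x y : PathCat k (Vert (LiftArrow F arr))} (q : Quiver.Path x.pt y.pt) :
    D.restrict hA hhom x y (PathCat.ofPath ((coverPrefunctor arr F).mapPath q)) =
      PathCat.ofPath q :=
  Finsupp.comapDomain_single _ _ _ (D.mapPath_injective hA hhom x.pt y.pt).injOn

theorem restrict_ofPath_eq_zero (D : CoveringDecomposition ρ F) (hA : IsArrowBasis k A arr)
    (hhom : ∀ (b c : B) (a : A b c), IsHomogeneous F (arr b c a))
    {x y : PathCat k (Vert (LiftArrow F arr))}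
    (q : Quiver.Path ((coverPrefunctor arr F).obj x.pt) ((coverPrefunctor arr F).obj y.pt))
    (hq : ∀ q' : Quiver.Path x.pt y.pt, (coverPrefunctor arr F).mapPath q' ≠ q) :
    D.restrict hA hhom x y (PathCat.ofPath q) = 0 := by
  refine Finsupp.ext fun q' => ?_
  exact Finsupp.single_eq_of_ne (hq q')

theorem comp_composePath (D : CoveringDecomposition ρ F) {x y : E}
    (q : Quiver.Path (⟨x⟩ : Vert (LiftArrow F arr)) ⟨y⟩) :
    D.comp x y (composePath ((arrowPrefunctor arr).mapPath ((coverPrefunctor arr F).mapPath q))) =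
      composePath ((arrowPrefunctor (liftArr F arr)).mapPath q) :=
  (congrArg (D.comp x y) (map_composePath_liftArr q).symm).trans (D.comp_map _)

/-- The path does lift from `x`, but its lift ends at another object `y'` of the fibre, so its value
lies in the summand of `y'`. -/
theorem comp_composePath_eq_zero (D : CoveringDecomposition ρ F) (hA : IsArrowBasis k A arr)
    (hhom : ∀ (b c : B) (a : A b c), IsHomogeneous F (arr b c a)) {x y : E}
    (q : Quiver.Path (⟨F.obj x⟩ : Vert A) ⟨F.obj y⟩)
    (hq : ∀ q' : Quiver.Path (⟨x⟩ : Vert (LiftArrow F arr)) ⟨y⟩,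
      (coverPrefunctor arr F).mapPath q' ≠ q) :
    D.comp x y (composePath ((arrowPrefunctor arr).mapPath q)) = 0 := by
  obtain ⟨⟨⟨y'⟩, q'⟩, hq'⟩ := ((coverPrefunctor arr F).pathStar_bijective
    (D.bijective_star hA hhom) ⟨x⟩).2 ⟨_, q⟩
  have e : F.obj y' = F.obj y := congrArg (fun s => s.1.pt) hq'
  have heq : HEq ((coverPrefunctor arr F).mapPath q') q := (Sigma.mk.inj hq').2
  have hy : y' ≠ y := by
    rintro rfl
    exact hq q' (eq_of_heq heq)
  have h := D.comp_of_ne (composePath ((arrowPrefunctor (liftArr F arr)).mapPath q')) e hy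
  rw [← h, map_composePath_liftArr]
  exact congrArg (D.comp x y) (composePath_arr_comp_eqToHom e heq).symm

/-- The link between relations and the decomposition: selecting the paths that lift to paths from
`x` to `y` computes the component at `(x, y)` of the value. On a single path, both sides are the
value of its lift, or zero if there is none. -/
theorem lift_map_restrict (D : CoveringDecomposition ρ F) (hA : IsArrowBasis k A arr)
    (hhom : ∀ (b c : B) (a : A b c), IsHomogeneous F (arr b c a))
    {x y : PathCat k (Vert (LiftArrow F arr))}
    (r : (PathCat.map k (coverPrefunctor arr F)).obj x ⟶
      (PathCat.map k (coverPrefunctor arr F)).obj y) :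
    (PathCat.lift k (arrowPrefunctor (liftArr F arr))).map (D.restrict hA hhom x y r) =
      D.comp x.pt.pt y.pt.pt ((PathCat.lift k (arrowPrefunctor arr)).map r) := by
  have h : PathCat.liftHom k (arrowPrefunctor (liftArr F arr)) x y ∘ₗ D.restrict hA hhom x y =
      D.comp x.pt.pt y.pt.pt ∘ₗ PathCat.liftHom k (arrowPrefunctor arr) _ _ := by
    refine PathCat.linearMap_ext fun q => ?_
    refine Eq.trans ?_ (congrArg (fun f => D.comp x.pt.pt y.pt.pt f)
      (PathCat.liftHom_ofPath (arrowPrefunctor arr) q).symm)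
    by_cases hq : ∃ q' : Quiver.Path x.pt y.pt, (coverPrefunctor arr F).mapPath q' = q
    · obtain ⟨q', rfl⟩ := hq
      refine Eq.trans ?_ (D.comp_composePath q').symm
      exact (congrArg (PathCat.liftHom k (arrowPrefunctor (liftArr F arr)) x y)
        (D.restrict_ofPath hA hhom q')).trans (PathCat.liftHom_ofPath _ q')
    · rw [not_exists] at hq
      refine Eq.trans ?_ (D.comp_composePath_eq_zero hA hhom q hq).symm
      exact (congrArg (PathCat.liftHom k (arrowPrefunctor (liftArr F arr)) x y)
        (D.restrict_ofPath_eq_zero hA hhom q hq)).trans (map_zero _)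
  exact LinearMap.congr_fun h r

theorem map_restrict (D : CoveringDecomposition ρ F) (hA : IsArrowBasis k A arr)
    (hhom : ∀ (b c : B) (a : A b c), IsHomogeneous F (arr b c a))
    {x y : PathCat k (Vert (LiftArrow F arr))}
    (r : (PathCat.map k (coverPrefunctor arr F)).obj x ⟶
      (PathCat.map k (coverPrefunctor arr F)).obj y)
    (hr : ∀ q ∈ (PathCat.coeffs r).support, ∃ q' : Quiver.Path x.pt y.pt,
      (coverPrefunctor arr F).mapPath q' = q) :
    (PathCat.map k (coverPrefunctor arr F)).map (D.restrict hA hhom x y r) = r :=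
  Finsupp.mapDomain_comapDomain _ (D.mapPath_injective hA hhom x.pt y.pt) (PathCat.coeffs r) hr

/-- A minimal relation one of whose paths lifts to a path from `x` to `y` lifts to a relation. -/
theorem exists_lift_relation (D : CoveringDecomposition ρ F) (hA : IsArrowBasis k A arr)
    (hhom : ∀ (b c : B) (a : A b c), IsHomogeneous F (arr b c a))
    {x y : PathCat k (Vert (LiftArrow F arr))}
    (r : (PathCat.map k (coverPrefunctor arr F)).obj x ⟶
      (PathCat.map k (coverPrefunctor arr F)).obj y)
    (hr : IsMinimalRelation (CatIdeal.ker k (PathCat.lift k (arrowPrefunctor arr))) r)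
    (q₀ : Quiver.Path x.pt y.pt)
    (hq₀ : (coverPrefunctor arr F).mapPath q₀ ∈ (PathCat.coeffs r).support) :
    ∃ r' : x ⟶ y,
      r' ∈ (CatIdeal.ker k (PathCat.lift k (arrowPrefunctor (liftArr F arr)))).hom x y ∧
      (PathCat.map k (coverPrefunctor arr F)).map r' = r := by
  classical
  obtain ⟨hr, -, hmin⟩ := hr
  rw [CatIdeal.mem_ker] at hr
  let P : Quiver.Path ((PathCat.map k (coverPrefunctor arr F)).obj x).pt
      ((PathCat.map k (coverPrefunctor arr F)).obj y).pt → Prop := fun q => ∃ q' :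
        Quiver.Path x.pt y.pt, (coverPrefunctor arr F).mapPath q' = q
  -- The subsum of the terms of `r` whose paths lift to paths from `x` to `y`.
  let s : (PathCat.map k (coverPrefunctor arr F)).obj x ⟶
      (PathCat.map k (coverPrefunctor arr F)).obj y :=
    PathCat.ofCoeffs ((PathCat.coeffs r).filter P)
  have hs : D.restrict hA hhom x y s = D.restrict hA hhom x y r :=
    Finsupp.ext fun q => Finsupp.filter_apply_pos P (PathCat.coeffs r) ⟨q, rfl⟩
  -- The restriction evaluates to a component of the value of `r`, which is zero.
  have hr' : (PathCat.lift k (arrowPrefunctor (liftArr F arr))).map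
      (D.restrict hA hhom x y r) = 0 := by
    rw [D.lift_map_restrict]
    exact (congrArg (D.comp x.pt.pt y.pt.pt) hr).trans (map_zero _)
  refine ⟨D.restrict hA hhom x y r, hr', D.map_restrict hA hhom r fun q hq => ?_⟩
  by_contra hP
  -- If some path of `r` did not lift, then `s` would be a proper subsum, nonempty thanks to `q₀`.
  -- It is the image of the restriction, a relation upstairs, so it would lie in the ideal, against
  -- minimality.
  refine hmin ((PathCat.coeffs r).support.filter P) ⟨_, Finset.mem_filter.2 ⟨hq₀, q₀, rfl⟩⟩
    ⟨Finset.filter_subset _ _, fun h => hP (Finset.mem_filter.1 (h hq)).2⟩ ?_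
  rw [← Finsupp.filter_eq_sum]
  have hmap : (PathCat.map k (coverPrefunctor arr F)).map (D.restrict hA hhom x y s) = s :=
    D.map_restrict hA hhom s fun q hq => (Finset.mem_filter.1 hq).2
  change (PathCat.lift k (arrowPrefunctor arr)).map s = 0
  rw [← hmap, hs, ← D.map_lift_map, hr']
  exact D.map_zero' _ _

theorem isBoundQuiverCovering (D : CoveringDecomposition ρ F) (hA : IsArrowBasis k A arr)
    (hhom : ∀ (b c : B) (a : A b c), IsHomogeneous F (arr b c a)) :
    IsBoundQuiverCovering (coverPrefunctor arr F)
      (CatIdeal.ker k (PathCat.lift k (arrowPrefunctor (liftArr F arr))))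
      (CatIdeal.ker k (PathCat.lift k (arrowPrefunctor arr))) := by
  have lift_source : ∀ (x' : PathCat k (Vert (LiftArrow F arr))) (y : PathCat k (Vert A))
      (r : (PathCat.map k (coverPrefunctor arr F)).obj x' ⟶ y),
      IsMinimalRelation (CatIdeal.ker k (PathCat.lift k (arrowPrefunctor arr))) r →
      ∃ (y' : PathCat k (Vert (LiftArrow F arr)))
        (hy : (PathCat.map k (coverPrefunctor arr F)).obj y' = y) (r' : x' ⟶ y'),
        r' ∈ (CatIdeal.ker k (PathCat.lift k (arrowPrefunctor (liftArr F arr)))).hom x' y' ∧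
        (PathCat.map k (coverPrefunctor arr F)).map r' ≫ eqToHom hy = r := by
    intro x' y r hr
    obtain ⟨q, hq⟩ := hr.2.1
    -- The end of the lift of any one path of `r` determines `y'`; minimality makes the other paths
    -- end there as well.
    obtain ⟨⟨y', q'⟩, hq'⟩ := ((coverPrefunctor arr F).pathStar_bijective
      (D.bijective_star hA hhom) x'.pt).2 ⟨y.pt, q⟩
    obtain ⟨y⟩ := y
    obtain rfl : (coverPrefunctor arr F).obj y' = y := congrArg Sigma.fst hq'
    obtain rfl : (coverPrefunctor arr F).mapPath q' = q := eq_of_heq (Sigma.mk.inj hq').2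
    obtain ⟨r', hr', e⟩ := D.exists_lift_relation hA hhom (y := ⟨y'⟩) r hr q' hq
    refine ⟨⟨y'⟩, rfl, r', hr', ?_⟩
    rw [e]
    exact Category.comp_id r
  refine ⟨D.mapsIdeal, fun ⟨b⟩ => ?_, D.bijective_star hA hhom, D.bijective_costar hA hhom,
    lift_source, fun y' x r hr => ?_⟩
  · obtain ⟨x, rfl⟩ := D.surjective b
    exact ⟨⟨x⟩, rfl⟩
  · obtain ⟨⟨b⟩⟩ := x
    obtain ⟨x₀, rfl⟩ := D.surjective b
    -- Lift from an arbitrary object over the source, then translate by the element of `G` that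
    -- moves the end reached to the prescribed one.
    obtain ⟨⟨⟨y₀⟩⟩, hy, r₀, hr₀, rfl⟩ := lift_source ⟨⟨x₀⟩⟩ _ r hr
    obtain ⟨⟨y₁⟩⟩ := y'
    obtain ⟨g, rfl⟩ := (D.obj_eq_iff y₀ y₁).1 (congrArg (fun z => z.pt.pt) hy)
    refine ⟨⟨⟨(ρ.act g).obj x₀⟩⟩, congrArg (fun b => (⟨⟨b⟩⟩ : PathCat k (Vert A))) (D.obj_act g x₀),
      (PathCat.map k (D.actPrefunctor arr g)).map r₀, D.mapsIdeal_act g _ _ r₀ hr₀, ?_⟩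
    have h : PathCat.map k (D.actPrefunctor arr g) ⋙ PathCat.map k (coverPrefunctor arr F) =
        PathCat.map k (coverPrefunctor arr F) := by
      rw [← PathCat.map_comp, D.actPrefunctor_comp_cover]
    exact Functor.congr_hom h r₀

/-- The fibres of `F` are the orbits of `G`, which gives transitivity, and freeness at a single
object makes `G` act faithfully. Connectedness of `E` passes to its quiver and then to the image. -/
theorem isGaloisBoundQuiverCovering [IsAlgClosed k] (D : CoveringDecomposition ρ F)
    (hE : IsLocallyBounded k E) (hB : IsLocallyBounded k B) (hA : IsArrowBasis k A arr)
    (hhom : ∀ (b c : B) (a : A b c), IsHomogeneous F (arr b c a))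
    (hconn : IsConnectedLinearCategory E) :
    IsGaloisBoundQuiverCovering G (coverPrefunctor arr F)
      (CatIdeal.ker k (PathCat.lift k (arrowPrefunctor (liftArr F arr))))
      (CatIdeal.ker k (PathCat.lift k (arrowPrefunctor arr))) := by
  have hA' := D.isArrowBasis_liftArr hE hB hA hhom
  have hW := hA'.isConnectedQuiver hE hconn
  refine ⟨D.isBoundQuiverCovering hA hhom, hW, ⟨hW.1.map (coverPrefunctor arr F).obj, ?_⟩,
    D.actPrefunctor arr, fun g h e => ?_, D.actPrefunctor_one, D.actPrefunctor_mul,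
    D.mapsIdeal_act, D.actPrefunctor_comp_cover, ?_⟩
  · rintro ⟨b⟩ ⟨c⟩
    obtain ⟨x, rfl⟩ := D.surjective b
    obtain ⟨y, rfl⟩ := D.surjective c
    exact (hW.2 ⟨x⟩ ⟨y⟩).lift (coverPrefunctor arr F).obj fun _ _ h =>
      h.imp (fun ⟨a⟩ => ⟨(coverPrefunctor arr F).map a⟩)
        fun ⟨a⟩ => ⟨(coverPrefunctor arr F).map a⟩
  · obtain ⟨x⟩ := hconn.1
    exact ρ.eq_of_obj_eq (x := x)
      (congrArg (fun p : Vert (LiftArrow F arr) ⥤q Vert (LiftArrow F arr) => (p.obj ⟨x⟩).pt) e)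
  · rintro ⟨x⟩ ⟨y⟩ h
    obtain ⟨g, rfl⟩ := (D.obj_eq_iff x y).1 (congrArg Vert.pt h)
    exact ⟨g, rfl⟩

end CoveringDecomposition

end

/-! ### Compatible admissible presentations of `E` and `B` -/

theorem proposition3p4 {k : Type w} [Field k] [IsAlgClosed k] {G : Type u₃} [Group G]
    {E : Type u₁} [Category.{v₁} E] [Preadditive E] [Linear k E]
    {B : Type u₂} [Category.{v₂} B] [Preadditive B] [Linear k B]
    (hE : IsLocallyBounded k E) (hB : IsLocallyBounded k B)
    (ρ : FreeGCategory k G E) (F : E ⥤ B) (hF : IsGaloisCovering ρ F) :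
    ∃ (A : B → B → Type) (A' : E → E → Type)
      (I : CatIdeal k (PathCat k (Vert A))) (J : CatIdeal k (PathCat k (Vert A')))
      (φ : IdealQuot I ⥤ B) (ψ : IdealQuot J ⥤ E)
      (p : Vert A' ⥤q Vert A) (hp : IsBoundQuiverCovering p J I),
      IsAdmissiblePresentation φ ∧ IsAdmissiblePresentation ψ ∧
      (∀ x : B, φ.obj ⟨⟨⟨x⟩⟩⟩ = x) ∧
      ψ ⋙ F = hp.functor ⋙ φ ∧
      (IsConnectedLinearCategory E → IsGaloisBoundQuiverCovering G p J I) := by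
  obtain ⟨D⟩ := hF.nonempty_decomposition
  obtain ⟨A, arr, hA, hhom⟩ := D.exists_homogeneous_arrowBasis hE hB
  have hA' := D.isArrowBasis_liftArr hE hB hA hhom
  -- Both ideals are kernels of evaluation: on the chosen homogeneous arrows downstairs and on their
  -- lifts upstairs.
  refine ⟨A, LiftArrow F arr, _, _,
    IdealQuot.kerLift k (PathCat.lift k (arrowPrefunctor arr)),
    IdealQuot.kerLift k (PathCat.lift k (arrowPrefunctor (liftArr F arr))),
    coverPrefunctor arr F, D.isBoundQuiverCovering hA hhom, hA.isAdmissiblePresentation hB,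
    hA'.isAdmissiblePresentation hE, fun _ => rfl, ?_,
    D.isGaloisBoundQuiverCovering hE hB hA hhom⟩
  refine CategoryTheory.Functor.hext (fun _ => rfl) fun x y f => heq_of_eq ?_
  obtain ⟨r, rfl⟩ := Submodule.Quotient.mk_surjective _ f
  exact D.map_lift_map r
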